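/- Throughout, a coloring of a graph $G=(V,E)$ is a map $c:V\to\{0,1,2,\dots\}$ with $c(u)\ne c(v)$ for adjacent $u,v$. A set $D\subseteq V$ is an up-color dominating $c$-set of $(G,c)$ if (1) every vertex $v\notin D$ has a neighbor $d\in D$ with $c(v)<c(d)$, and (2) $D$ contains no vertex of color $0$. The weight of $D$ is $\sum_{v\in D}c(v)$; $\omega_{uc}(G,c)$ denotes the minimum weight of an up-color dominating $c$-set, and an $\omega_{uc}$-dominating $c$-set is an up-color dominating $c$-set of weight $\omega_{uc}(G,c)$. **Theorem.** There is an algorithm which, given any pair $(T,c)$, where $T$ is a tree with $n$ vertices and $c$ is a coloring of $T$ that is not identically $0$ (this excludes only the one-vertex tree with color $0$, which has no up-color dominating $c$-set), computes an $\omega_{uc}$-dominating $c$-set of $T$ with computational cost $\mathcal O(n^2\log n)$ and memory cost $\mathcal O(n^2)$. Here the algorithm is one fixed program for a random access machine with finitely many registers and an indirectly addressed memory, with control by sequencing, conditionals and while-loops testing $R_r<R_s$. The elementary instructions (no-op, loading a constant, copying, addition, truncated subtraction, reading and writing a memory cell) and the tests cost one step each. The vertices are $0,\dots,n-1$; the input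 in memory consists of $n$, the colors, and a list of the edges in arbitrary order and orientation, and the output is the characteristic vector of the set in the memory cells $0,\dots,n-1$. The computational cost is the number of steps, and the memory cost is the number $s$ of words such that only addresses below $s$ are accessed. All numbers occurring during the computation are at most $\left(n+\sum_v c(v)\right)^K$ for a constant $K$, i.e. words have $\mathcal O(\log (n+\sum_v c(v)))$ bits. Both bounds depend only on $n$, and not on the colors. -/

import Mathlib

namespace UpColor

/-! ### Up-colour domination -/

section Domination

variable {V : Type*} (G : SimpleGraph V) (c : G.Coloring ℕ)

/-- `D` is an up-colour dominating `c`-set of `(G, c)`: every vertex outside `D` has a neighbour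
in `D` of strictly larger colour, and `D` contains no vertex of colour `0`. -/
def IsUpColorDominating (D : Finset V) : Prop :=
  (∀ v, v ∉ D → ∃ d ∈ D, G.Adj v d ∧ c v < c d) ∧ ∀ d ∈ D, c d ≠ 0

/-- The weight of a set of vertices: the sum of the colours of its members. -/
def weight (D : Finset V) : ℕ := ∑ v ∈ D, c v

/-- The up-colour domination `c`-weight `ω_uc(G, c)`: the minimum weight of an up-colour
dominating `c`-set. -/
noncomputable def omegaUC : ℕ :=
  sInf {w | ∃ D : Finset V, IsUpColorDominating G c D ∧ weight G c D = w}

/-- `D` is an `ω_uc`-dominating `c`-set: an up-colour dominating `c`-set of minimum weight. -/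
def IsOmegaUCDominating (D : Finset V) : Prop :=
  IsUpColorDominating G c D ∧ weight G c D = omegaUC G c

end Domination

/-! ### Random access machine with unit-cost instructions -/

/-- Programs of a random access machine. The machine has registers (a program names only finitely
many of them) and an indirectly addressed memory. There are no arithmetic operations besides
addition and truncated subtraction. -/
inductive Program where
  /-- do nothing -/
  | skip
  /-- `R[r] := k` -/
  | const (r k : ℕ)
  /-- `R[r] := R[s]` -/
  | copy (r s : ℕ)
  /-- `R[r] := R[s] + R[t]` -/
  | add (r s t : ℕ)
  /-- `R[r] := max (R[s] - R[t]) 0` -/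
  | sub (r s t : ℕ)
  /-- `R[r] := M[R[s]]` -/
  | load (r s : ℕ)
  /-- `M[R[r]] := R[s]` -/
  | store (r s : ℕ)
  /-- sequential composition -/
  | seq (P Q : Program)
  /-- if `R[r] < R[s]` then `P` else `Q` -/
  | ifLt (r s : ℕ) (P Q : Program)
  /-- while `R[r] < R[s]` do `P` -/
  | whileLt (r s : ℕ) (P : Program)

/-- A state of the machine: the contents of the registers and of the memory. -/
structure State where
  reg : ℕ → ℕ
  mem : ℕ → ℕ

/-- The state after writing `x` into register `r`. -/
def State.setReg (σ : State) (r x : ℕ) : State :=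
  { σ with reg := Function.update σ.reg r x }

/-- The state after writing `x` into memory cell `a`. -/
def State.setMem (σ : State) (a x : ℕ) : State :=
  { σ with mem := Function.update σ.mem a x }

/-- `Exec S W P σ t τ`: started in state `σ`, on a machine with `S` memory cells (of addresses
`0, …, S - 1`) and words that can hold the numbers `0, …, W`, the program `P` halts in state `τ`
after exactly `t` steps. Every elementary instruction and every evaluation of a test takes one
step. An access to an address outside the memory, or a number larger than `W`, is a fault: then
there is no halting execution. -/
inductive Exec (S W : ℕ) : Program → State → ℕ → State → Prop where
  | skip (σ : State) : Exec S W .skip σ 1 σ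
  | const (σ : State) (r k : ℕ) (hW : k ≤ W) :
      Exec S W (.const r k) σ 1 (σ.setReg r k)
  | copy (σ : State) (r s : ℕ) :
      Exec S W (.copy r s) σ 1 (σ.setReg r (σ.reg s))
  | add (σ : State) (r s t : ℕ) (hW : σ.reg s + σ.reg t ≤ W) :
      Exec S W (.add r s t) σ 1 (σ.setReg r (σ.reg s + σ.reg t))
  | sub (σ : State) (r s t : ℕ) :
      Exec S W (.sub r s t) σ 1 (σ.setReg r (σ.reg s - σ.reg t))
  | load (σ : State) (r s : ℕ) (hS : σ.reg s < S) :
      Exec S W (.load r s) σ 1 (σ.setReg r (σ.mem (σ.reg s)))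
  | store (σ : State) (r s : ℕ) (hS : σ.reg r < S) :
      Exec S W (.store r s) σ 1 (σ.setMem (σ.reg r) (σ.reg s))
  | seq {P Q : Program} {σ τ υ : State} {t u : ℕ}
      (hP : Exec S W P σ t τ) (hQ : Exec S W Q τ u υ) :
      Exec S W (.seq P Q) σ (t + u) υ
  | ifTrue {r s : ℕ} {P Q : Program} {σ τ : State} {t : ℕ}
      (h : σ.reg r < σ.reg s) (hP : Exec S W P σ t τ) :
      Exec S W (.ifLt r s P Q) σ (1 + t) τ
  | ifFalse {r s : ℕ} {P Q : Program} {σ τ : State} {t : ℕ}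
      (h : ¬ σ.reg r < σ.reg s) (hQ : Exec S W Q σ t τ) :
      Exec S W (.ifLt r s P Q) σ (1 + t) τ
  | whileTrue {r s : ℕ} {P : Program} {σ τ υ : State} {t u : ℕ}
      (h : σ.reg r < σ.reg s) (hP : Exec S W P σ t τ)
      (hloop : Exec S W (.whileLt r s P) τ u υ) :
      Exec S W (.whileLt r s P) σ (1 + t + u) υ
  | whileFalse {r s : ℕ} {P : Program} {σ : State}
      (h : ¬ σ.reg r < σ.reg s) :
      Exec S W (.whileLt r s P) σ 1 σ

/-! ### Input and output conventions -/

/-- `L` lists every edge of `G` exactly once, in any order and with the two ends of each edge in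
any order. -/
def IsEdgeList {V : Type*} (G : SimpleGraph V) (L : List (V × V)) : Prop :=
  (L.map fun e => s(e.1, e.2)).Nodup ∧
    ∀ x : Sym2 V, x ∈ (L.map fun e => s(e.1, e.2)) ↔ x ∈ G.edgeSet

/-- The input as a sequence of words: the number `n` of vertices, the colours of the vertices
`0, …, n - 1`, and the ends of the listed edges one after another. -/
def inputWords {n : ℕ} (c : Fin n → ℕ) (L : List (Fin n × Fin n)) : List ℕ :=
  n :: (List.ofFn c ++ L.flatMap fun e => [(e.1 : ℕ), (e.2 : ℕ)])

/-- The initial state: the input stands at the beginning of the memory; all other memory cells and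
all registers are `0`. -/
def initialState {n : ℕ} (c : Fin n → ℕ) (L : List (Fin n × Fin n)) : State where
  reg := fun _ => 0
  mem := fun a => (inputWords c L).getD a 0

/-- The memory cells `0, …, n - 1` hold the characteristic vector of `D`. -/
def Outputs {n : ℕ} (σ : State) (D : Finset (Fin n)) : Prop :=
  ∀ i : Fin n, σ.mem i = if i ∈ D then 1 else 0

end UpColor

namespace UpColor

/-! ### A register language with arrays -/

/-! A tree grows from the vertex `0` by attaching, at step `k`, a new vertex `U k` to a seen vertex
`P k`; read backwards, it is dismantled leaf by leaf. Every vertex carries three costs: `a` if it is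
in the set, `e` if it is outside and dominated within the part of the tree still present, `b` if it
is outside and not so dominated. At the start `a` is the colour, `e` is `0`, and `b` is a penalty
exceeding every weight; the penalty also replaces `a` at colour `0`.

Removing a leaf `u` at `p` minimises over the two states of `u` and charges the result to `p`. By
`setCost_merge` no other vertex is affected, and `Solves.merge` keeps the invariant that the current
cost of a set is the least full cost among its extensions. The choices are recorded in three tables,
one for each state of `p`, so a forward pass from the best state of the root rebuilds a minimiser
(`Solves.root`). The set of all vertices of nonzero colour is admissible and costs less than one
penalty. Hence a minimiser pays no penalty and is an optimal dominating set
(`isOmegaUCDominating_of_forall_fullCost_le`).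

The growth order comes from scanning the edge list `n` times: by connectedness, a pass that attaches
nothing has already seen every vertex (`wp_grow`). The `n - 1` edges so used are all edges of the
tree (`IsTreeGrowth.natAdj_iff`). This is the only nested loop, so the time is quadratic.

The program is written in an array language with a weakest precondition that also limits loop
counts. `exists_exec_of_wp` carries correctness over to the machine, and `exists_cost_le` bounds the
steps. Fifteen arrays of length `3 * n` make the memory linear, and `Solves.bound` keeps the numbers
small. -/

/-- Commands of a small language with registers and arrays. The arrays are numbered. -/
inductive Cmd where
  | const (r k : ℕ)
  | copy (r s : ℕ)
  | add (r s t : ℕ)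
  | sub (r s t : ℕ)
  /-- `R[r] := A[a][R[s]]` -/
  | load (r a s : ℕ)
  /-- `A[a][R[r]] := R[s]` -/
  | store (a r s : ℕ)
  | seq (P Q : Cmd)
  | ifLt (r s : ℕ) (P Q : Cmd)
  | whileLt (r s : ℕ) (P : Cmd)

/-- A state of the array language. -/
@[ext] structure AState where
  reg : ℕ → ℕ
  arr : ℕ → ℕ → ℕ

namespace AState

def setReg (h : AState) (r x : ℕ) : AState :=
  { h with reg := fun s => if s = r then x else h.reg s }

def setArr (h : AState) (a i x : ℕ) : AState :=
  { h with arr := fun b => if b = a then Function.update (h.arr a) i x else h.arr b }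

@[simp] theorem reg_setReg (h : AState) (r x s : ℕ) :
    (h.setReg r x).reg s = if s = r then x else h.reg s := rfl

@[simp] theorem arr_setReg (h : AState) (r x : ℕ) : (h.setReg r x).arr = h.arr := rfl

@[simp] theorem reg_setArr (h : AState) (a i x : ℕ) : (h.setArr a i x).reg = h.reg := rfl

@[simp] theorem arr_setArr (h : AState) (a i x b : ℕ) :
    (h.setArr a i x).arr b = if b = a then Function.update (h.arr a) i x else h.arr b := rfl

end AState

namespace Cmd

/-- Register `1` of the machine is advanced by `k` times the array length, which stands in
register `0`. -/
def advance : ℕ → Program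
  | 0 => .skip
  | k + 1 => .seq (advance k) (.add 1 1 0)

/-- The machine program of a command. Arrays of equal length lie one after another. Register `0`
holds that length, and register `1` is used for addresses. -/
def compile : Cmd → Program
  | const r k => .const (r + 2) k
  | copy r s => .copy (r + 2) (s + 2)
  | add r s t => .add (r + 2) (s + 2) (t + 2)
  | sub r s t => .sub (r + 2) (s + 2) (t + 2)
  | load r a s => .seq (.copy 1 (s + 2)) (.seq (advance a) (.load (r + 2) 1))
  | store a r s => .seq (.copy 1 (r + 2)) (.seq (advance a) (.store 1 (s + 2)))
  | seq P Q => .seq (compile P) (compile Q)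
  | ifLt r s P Q => .ifLt (r + 2) (s + 2) (compile P) (compile Q)
  | whileLt r s P => .whileLt (r + 2) (s + 2) (compile P)

/-- A bound for the number of steps when every loop runs at most `n` times. -/
def cost (n : ℕ) : Cmd → ℕ
  | const _ _ => 1
  | copy _ _ => 1
  | add _ _ _ => 1
  | sub _ _ _ => 1
  | load _ a _ => a + 3
  | store a _ _ => a + 3
  | seq P Q => cost n P + cost n Q
  | ifLt _ _ P Q => 1 + cost n P + cost n Q
  | whileLt _ _ P => n * (1 + cost n P) + 1

/-- The nesting depth of loops. -/
def depth : Cmd → ℕ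
  | seq P Q => max (depth P) (depth Q)
  | ifLt _ _ P Q => max (depth P) (depth Q)
  | whileLt _ _ P => depth P + 1
  | _ => 0

/-- Each level of loop nesting contributes one factor `n`, and the command itself is fixed. For a
program of depth two this is the quadratic time bound. -/
theorem exists_cost_le (C : Cmd) : ∃ A, ∀ n, cost n C ≤ A * (n + 1) ^ depth C := by
  have key : ∀ (n A d e : ℕ), d ≤ e → A * (n + 1) ^ d ≤ A * (n + 1) ^ e := fun n A d e h =>
    Nat.mul_le_mul_left _ (Nat.pow_le_pow_right (Nat.succ_pos n) h)
  induction C with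
  | const r k => exact ⟨1, fun n => by simp [cost, depth]⟩
  | copy r s => exact ⟨1, fun n => by simp [cost, depth]⟩
  | add r s t => exact ⟨1, fun n => by simp [cost, depth]⟩
  | sub r s t => exact ⟨1, fun n => by simp [cost, depth]⟩
  | load r a s => exact ⟨a + 3, fun n => by simp [cost, depth]⟩
  | store a r s => exact ⟨a + 3, fun n => by simp [cost, depth]⟩
  | seq P Q hP hQ =>
    obtain ⟨A, hA⟩ := hP
    obtain ⟨B, hB⟩ := hQ
    refine ⟨A + B, fun n => ?_⟩
    have h1 := (hA n).trans (key n A _ _ (le_max_left (depth P) (depth Q)))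
    have h2 := (hB n).trans (key n B _ _ (le_max_right (depth P) (depth Q)))
    simp only [cost, depth, add_mul]
    omega
  | ifLt r s P Q hP hQ =>
    obtain ⟨A, hA⟩ := hP
    obtain ⟨B, hB⟩ := hQ
    refine ⟨1 + A + B, fun n => ?_⟩
    have h1 := (hA n).trans (key n A _ _ (le_max_left (depth P) (depth Q)))
    have h2 := (hB n).trans (key n B _ _ (le_max_right (depth P) (depth Q)))
    have h3 : 1 ≤ (n + 1) ^ max (depth P) (depth Q) := Nat.one_le_pow _ _ (Nat.succ_pos n)
    simp only [cost, depth, add_mul]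
    omega
  | whileLt r s P hP =>
    obtain ⟨A, hA⟩ := hP
    refine ⟨A + 1, fun n => ?_⟩
    have h1 := hA n
    have h3 : 1 ≤ (n + 1) ^ depth P := Nat.one_le_pow _ _ (Nat.succ_pos n)
    simp only [cost, depth, pow_succ]
    nlinarith

/-- Weakest precondition: `C`, started in the given state on arrays of length `3 * n` with numbers
up to `W` and `N` arrays, halts without a fault in a state with `Q`, and every loop runs at most `n`
times. -/
def wp (n W N : ℕ) : Cmd → (AState → Prop) → AState → Prop
  | const r k, Q, h => k ≤ W ∧ Q (h.setReg r k)
  | copy r s, Q, h => Q (h.setReg r (h.reg s))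
  | add r s t, Q, h => h.reg s + h.reg t ≤ W ∧ Q (h.setReg r (h.reg s + h.reg t))
  | sub r s t, Q, h => Q (h.setReg r (h.reg s - h.reg t))
  | load r a s, Q, h => (a < N ∧ h.reg s < 3 * n) ∧ Q (h.setReg r (h.arr a (h.reg s)))
  | store a r s, Q, h => (a < N ∧ h.reg r < 3 * n) ∧ Q (h.setArr a (h.reg r) (h.reg s))
  | seq P P', Q, h => wp n W N P (wp n W N P' Q) h
  | ifLt r s P P', Q, h =>
      (h.reg r < h.reg s → wp n W N P Q h) ∧ (¬ h.reg r < h.reg s → wp n W N P' Q h)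
  | whileLt r s P, Q, h =>
      -- The invariant is indexed by the number of completed iterations and the exact count `m` is a
      -- witness, so correctness, termination and the iteration bound are settled together.
      ∃ (m : ℕ) (I : ℕ → AState → Prop), m ≤ n ∧ I 0 h ∧
        (∀ k < m, ∀ g, I k g → g.reg r < g.reg s ∧ wp n W N P (I (k + 1)) g) ∧
        ∀ g, I m g → ¬ g.reg r < g.reg s ∧ Q g

theorem wp_mono {n W N : ℕ} (C : Cmd) {Q R : AState → Prop} (hQR : ∀ h, Q h → R h) {h : AState}
    (hC : wp n W N C Q h) : wp n W N C R h := by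
  induction C generalizing Q R h with
  | const r k => exact ⟨hC.1, hQR _ hC.2⟩
  | copy r s => exact hQR _ hC
  | add r s t => exact ⟨hC.1, hQR _ hC.2⟩
  | sub r s t => exact hQR _ hC
  | load r a s => exact ⟨hC.1, hQR _ hC.2⟩
  | store a r s => exact ⟨hC.1, hQR _ hC.2⟩
  | seq P P' hP hP' => exact hP (fun _ => hP' hQR) hC
  | ifLt r s P P' hP hP' => exact ⟨fun h => hP hQR (hC.1 h), fun h => hP' hQR (hC.2 h)⟩
  | whileLt r s P hP =>
    obtain ⟨m, I, hm, h0, h1, h2⟩ := hC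
    exact ⟨m, I, hm, h0, h1, fun g hg => ⟨(h2 g hg).1, hQR _ (h2 g hg).2⟩⟩

theorem wp_seq {n W N : ℕ} {C C' : Cmd} {Q R : AState → Prop} {h : AState}
    (hC : wp n W N C R h) (hC' : ∀ g, R g → wp n W N C' Q g) : wp n W N (seq C C') Q h :=
  wp_mono C hC' hC

/-- The machine state `σ` represents the array state `h`. -/
def Rep (n : ℕ) (σ : State) (h : AState) : Prop :=
  σ.reg 0 = 3 * n ∧ (∀ r, σ.reg (r + 2) = h.reg r) ∧
    ∀ k i, i < 3 * n → σ.mem (k * (3 * n) + i) = h.arr k i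

theorem Rep.setReg {n : ℕ} {σ : State} {h : AState} (hR : Rep n σ h) (r x : ℕ) :
    Rep n (σ.setReg (r + 2) x) (h.setReg r x) := by
  obtain ⟨h0, h1, h2⟩ := hR
  refine ⟨by simpa [State.setReg] using h0, fun s => ?_, h2⟩
  by_cases hs : s = r <;> simp [State.setReg, hs, h1]

theorem Rep.setReg_one {n : ℕ} {σ : State} {h : AState} (hR : Rep n σ h) (x : ℕ) :
    Rep n (σ.setReg 1 x) h := by
  obtain ⟨h0, h1, h2⟩ := hR
  exact ⟨by simpa [State.setReg] using h0,
    fun s => by simpa [State.setReg, Function.update_apply] using h1 s, h2⟩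

theorem Rep.setMem {n : ℕ} {σ : State} {h : AState} (hR : Rep n σ h) (a i x : ℕ)
    (hi : i < 3 * n) : Rep n (σ.setMem (a * (3 * n) + i) x) (h.setArr a i x) := by
  obtain ⟨h0, h1, h2⟩ := hR
  refine ⟨h0, h1, fun k j hj => ?_⟩
  have hpos : 0 < 3 * n := by omega
  by_cases hk : k = a
  · subst hk
    simp [State.setMem, Function.update_apply, h2 k j hj]
  · have hne : k * (3 * n) + j ≠ a * (3 * n) + i := by
      intro he
      apply hk
      -- The quotient by the array length recovers the array number, so distinct arrays occupy
      -- disjoint blocks.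
      have := congrArg (· / (3 * n)) he
      simpa [mul_comm _ (3 * n), Nat.mul_add_div hpos, Nat.div_eq_of_lt hj,
        Nat.div_eq_of_lt hi] using this
    simp [State.setMem, h2 k j hj, hk, hne]

/-- There is no multiplication, so the block is reached by `a` additions of the array length. Every
partial sum is at most the final address, so a single word bound suffices. -/
theorem exec_advance {n S W : ℕ} (a : ℕ) {σ : State} {h : AState} (hR : Rep n σ h) {i : ℕ}
    (hi : σ.reg 1 = i) (hW : a * (3 * n) + i ≤ W) :
    ∃ τ, Exec S W (advance a) σ (a + 1) τ ∧ τ.reg 1 = a * (3 * n) + i ∧ Rep n τ h := by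
  induction a with
  | zero => exact ⟨σ, .skip σ, by simpa using hi, hR⟩
  | succ a ih =>
    have hle : a * (3 * n) + i + 3 * n ≤ W := by
      have : (a + 1) * (3 * n) = a * (3 * n) + 3 * n := by ring
      omega
    obtain ⟨τ, hτ, h1, hr⟩ := ih (by omega)
    refine ⟨τ.setReg 1 (τ.reg 1 + τ.reg 0), .seq hτ (.add τ 1 1 0 (by rw [h1, hr.1]; exact hle)),
      ?_, hr.setReg_one _⟩
    simp only [State.setReg, Function.update_self, h1, hr.1]
    ring

/-- Soundness of the weakest precondition, by structural induction: every access stays in the block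
of its array, and `hW` makes room for the address arithmetic. -/
theorem exists_exec_of_wp {n W N : ℕ} (hW : N * (3 * n) ≤ W) (C : Cmd) {Q : AState → Prop}
    {h : AState} (hC : wp n W N C Q h) {σ : State} (hR : Rep n σ h) :
    ∃ t τ g, t ≤ cost n C ∧ Exec (N * (3 * n)) W (compile C) σ t τ ∧ Rep n τ g ∧ Q g := by
  have haddr : ∀ a i, a < N → i < 3 * n → a * (3 * n) + i < N * (3 * n) := by
    intro a i ha hi
    have : (a + 1) * (3 * n) ≤ N * (3 * n) := Nat.mul_le_mul_right _ ha
    have : (a + 1) * (3 * n) = a * (3 * n) + 3 * n := by ring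
    omega
  induction C generalizing Q h σ with
  | const r k => exact ⟨1, _, _, le_rfl, .const σ _ k hC.1, hR.setReg r k, hC.2⟩
  | copy r s =>
    refine ⟨1, _, _, le_rfl, .copy σ _ _, ?_, hC⟩
    rw [hR.2.1]
    exact hR.setReg r _
  | add r s t =>
    refine ⟨1, _, _, le_rfl, .add σ _ _ _ (by rw [hR.2.1, hR.2.1]; exact hC.1), ?_, hC.2⟩
    rw [hR.2.1, hR.2.1]
    exact hR.setReg r _
  | sub r s t =>
    refine ⟨1, _, _, le_rfl, .sub σ _ _ _, ?_, hC⟩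
    rw [hR.2.1, hR.2.1]
    exact hR.setReg r _
  | load r a s =>
    obtain ⟨⟨ha, hs⟩, hQ⟩ := hC
    have hlt := haddr a _ ha hs
    obtain ⟨τ, hτ, h1, hr⟩ := exec_advance (S := N * (3 * n)) (W := W) a (i := h.reg s)
      (hR.setReg_one (σ.reg (s + 2))) (by simp [State.setReg, hR.2.1]) (by omega)
    refine ⟨1 + (a + 1 + 1), _, _, by simp only [cost]; omega,
      .seq (.copy σ _ _) (.seq hτ (.load τ _ _ (by rw [h1]; exact hlt))), ?_, hQ⟩
    rw [h1, hr.2.2 _ _ hs]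
    exact hr.setReg r _
  | store a r s =>
    obtain ⟨⟨ha, hs⟩, hQ⟩ := hC
    have hlt := haddr a _ ha hs
    obtain ⟨τ, hτ, h1, hr⟩ := exec_advance (S := N * (3 * n)) (W := W) a (i := h.reg r)
      (hR.setReg_one (σ.reg (r + 2))) (by simp [State.setReg, hR.2.1]) (by omega)
    refine ⟨1 + (a + 1 + 1), _, _, by simp only [cost]; omega,
      .seq (.copy σ _ _) (.seq hτ (.store τ _ _ (by rw [h1]; exact hlt))), ?_, hQ⟩
    rw [h1, hr.2.1 s]
    exact hr.setMem a _ _ hs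
  | seq P P' hP hP' =>
    obtain ⟨t, τ, g, ht, he, hr, hw⟩ := hP hC hR
    obtain ⟨t', τ', g', ht', he', hr', hq⟩ := hP' hw hr
    exact ⟨_, _, _, Nat.add_le_add ht ht', .seq he he', hr', hq⟩
  | ifLt r s P P' hP hP' =>
    by_cases hlt : h.reg r < h.reg s
    · obtain ⟨t, τ, g, ht, he, hr, hq⟩ := hP (hC.1 hlt) hR
      exact ⟨_, _, _, by simp only [cost]; omega,
        .ifTrue (by rw [hR.2.1, hR.2.1]; exact hlt) he, hr, hq⟩
    · obtain ⟨t, τ, g, ht, he, hr, hq⟩ := hP' (hC.2 hlt) hR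
      exact ⟨_, _, _, by simp only [cost]; omega,
        .ifFalse (by rw [hR.2.1, hR.2.1]; exact hlt) he, hr, hq⟩
  | whileLt r s P hP =>
    obtain ⟨m, I, hm, h0, h1, h2⟩ := hC
    -- Induction on the number `d` of iterations still to run, for all states satisfying the
    -- invariant.
    have key : ∀ d k, k + d = m → ∀ h σ, I k h → Rep n σ h → ∃ t τ g,
        t ≤ d * (1 + cost n P) + 1 ∧
        Exec (N * (3 * n)) W (compile (.whileLt r s P)) σ t τ ∧ Rep n τ g ∧ Q g := by
      intro d
      induction d with
      | zero =>
        rintro k rfl h σ hI hR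
        obtain ⟨hn, hq⟩ := h2 h hI
        exact ⟨1, σ, h, by simp, .whileFalse (by rw [hR.2.1, hR.2.1]; exact hn), hR, hq⟩
      | succ d ih =>
        intro k hk h σ hI hR
        obtain ⟨hlt, hw⟩ := h1 k (by omega) h hI
        obtain ⟨t, τ, g, ht, he, hr, hi⟩ := hP hw hR
        obtain ⟨t', τ', g', ht', he', hr', hq⟩ := ih (k + 1) (by omega) g τ hi hr
        refine ⟨1 + t + t', τ', g', ?_, .whileTrue (by rw [hR.2.1, hR.2.1]; exact hlt) he he',
          hr', hq⟩
        rw [add_mul]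
        omega
    obtain ⟨t, τ, g, ht, hrest⟩ := key m 0 (by omega) h σ h0 hR
    refine ⟨t, τ, g, ht.trans ?_, hrest⟩
    simp only [cost]
    exact Nat.add_le_add_right (Nat.mul_le_mul_right _ hm) 1

/-- `for R[i] := 0 to R[b] - 1 do P`, where register `1` holds the number `1`. -/
def forUp (i b : ℕ) (P : Cmd) : Cmd :=
  seq (const i 0) (whileLt i b (seq P (add i i 1)))

/-- The body must leave the counter and the constant register `1` intact; the next invariant is
demanded of the state after the increment. -/
theorem wp_forUp {n W N : ℕ} {i b : ℕ} {P : Cmd} {Q : AState → Prop} {h : AState} (m : ℕ)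
    (hm : m ≤ n) (hW : m ≤ W) (I : ℕ → AState → Prop) (h0 : I 0 (h.setReg i 0))
    (hI : ∀ k g, I k g → g.reg i = k ∧ g.reg b = m)
    (hstep : ∀ k < m, ∀ g, I k g → wp n W N P
      (fun g' => g'.reg 1 = 1 ∧ g'.reg i = k ∧ I (k + 1) (g'.setReg i (k + 1))) g)
    (hQ : ∀ g, I m g → Q g) : wp n W N (forUp i b P) Q h := by
  refine ⟨Nat.zero_le _, m, I, hm, h0, fun k hk g hg => ⟨?_, ?_⟩, fun g hg => ⟨?_, hQ g hg⟩⟩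
  · rw [(hI k g hg).1, (hI k g hg).2]
    exact hk
  · refine wp_mono P ?_ (hstep k hk g hg)
    rintro g' ⟨h1, h2, h3⟩
    simp only [wp, h1, h2]
    exact ⟨by omega, h3⟩
  · rw [(hI m g hg).1, (hI m g hg).2]
    exact lt_irrefl m

end Cmd

/-! ### Dynamic programming along a growth order -/

section Growth

variable (c U P : ℕ → ℕ)

/-- The vertices seen after `k` steps, when step `j` attaches the new vertex `U j` to the vertex
`P j` and the first vertex is `0`. -/
def seen (k : ℕ) : Finset ℕ := insert 0 ((Finset.range k).image U)

/-- Every one of the first `m` steps attaches a new vertex to a vertex seen before. -/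
def IsGrowth (m : ℕ) : Prop := ∀ k < m, P k ∈ seen U k ∧ U k ∉ seen U k

/-- `v` has a neighbour of larger colour in the set `{w | 0 < x w}`, in the tree formed by the first
`k` edges. -/
def UpDom (k : ℕ) (x : ℕ → ℕ) (v : ℕ) : Prop :=
  ∃ j < k, (v = U j ∧ 0 < x (P j) ∧ c v < c (P j)) ∨ (v = P j ∧ 0 < x (U j) ∧ c v < c (U j))

open Classical in
/-- The cost of the set `{v | 0 < x v}` in the tree formed by the first `k` edges: a member `v`
costs `a v`, another vertex `v` costs `e v` if it is dominated and `b v` if it is not. -/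
noncomputable def setCost (a e b : ℕ → ℕ) (k : ℕ) (x : ℕ → ℕ) : ℕ :=
  ∑ v ∈ seen U k, if 0 < x v then a v else if UpDom c U P k x v then e v else b v

open Classical in
/-- The entry for the new vertex of step `k`, taken from one of three tables. -/
noncomputable def choice (dI dE dB : ℕ → ℕ) (k : ℕ) (x : ℕ → ℕ) : ℕ :=
  if 0 < x (P k) then dI k else if UpDom c U P k x (P k) then dE k else dB k

/-- Extend a set along `d` steps, beginning with step `k`. -/
noncomputable def extend (dI dE dB : ℕ → ℕ) : ℕ → ℕ → (ℕ → ℕ) → ℕ → ℕ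
  | 0, _, x => x
  | d + 1, k, x =>
    extend dI dE dB d (k + 1) (Function.update x (U k) (choice c U P dI dE dB k x))

/-- The local costs `a`, `e`, `b` on the tree formed by the first `k` of `m` edges are the minimal
values of `full`, attained by extending along the tables. -/
def Solves (dI dE dB : ℕ → ℕ) (m : ℕ) (full : (ℕ → ℕ) → ℕ) (a e b : ℕ → ℕ) (k : ℕ) : Prop :=
  ∀ x, full (extend c U P dI dE dB (m - k) k x) = setCost c U P a e b k x ∧
    setCost c U P a e b k x ≤ full x

variable {c U P}

theorem seen_succ (k : ℕ) : seen U (k + 1) = insert (U k) (seen U k) := by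
  simp [seen, Finset.range_add_one, Finset.image_insert, Finset.insert_comm]

theorem zero_mem_seen (k : ℕ) : 0 ∈ seen U k := Finset.mem_insert_self _ _

theorem seen_mono {j k : ℕ} (h : j ≤ k) : seen U j ⊆ seen U k :=
  Finset.insert_subset_insert _ (Finset.image_subset_image (Finset.range_mono h))

theorem mem_seen_of_lt {j k : ℕ} (h : j < k) : U j ∈ seen U k :=
  seen_mono (Nat.succ_le_of_lt h) (by rw [seen_succ]; exact Finset.mem_insert_self _ _)

theorem IsGrowth.mono {m k : ℕ} (hG : IsGrowth U P m) (h : k ≤ m) : IsGrowth U P k :=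
  fun j hj => hG j (hj.trans_le h)

theorem IsGrowth.parent_mem {m j k : ℕ} (hG : IsGrowth U P m) (hk : k ≤ m) (h : j < k) :
    P j ∈ seen U k :=
  seen_mono h.le (hG j (h.trans_le hk)).1

theorem IsGrowth.card_seen {m : ℕ} (hG : IsGrowth U P m) : (seen U m).card = m + 1 := by
  induction m with
  | zero => simp [seen]
  | succ m ih =>
    rw [seen_succ, Finset.card_insert_of_notMem (hG m (Nat.lt_succ_self m)).2,
      ih (hG.mono (Nat.le_succ m))]

theorem upDom_congr {m k : ℕ} (hG : IsGrowth U P m) (hk : k ≤ m) {x y : ℕ → ℕ}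
    (hxy : ∀ v ∈ seen U k, x v = y v) (v : ℕ) : UpDom c U P k x v ↔ UpDom c U P k y v := by
  refine exists_congr fun j => and_congr_right fun hj => ?_
  rw [hxy _ (mem_seen_of_lt hj), hxy _ (hG.parent_mem hk hj)]

theorem upDom_succ (k : ℕ) (x : ℕ → ℕ) (v : ℕ) :
    UpDom c U P (k + 1) x v ↔ UpDom c U P k x v ∨
      (v = U k ∧ 0 < x (P k) ∧ c v < c (P k)) ∨ (v = P k ∧ 0 < x (U k) ∧ c v < c (U k)) := by
  constructor
  · rintro ⟨j, hj, h⟩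
    rcases Nat.lt_succ_iff_lt_or_eq.mp hj with hj | rfl
    · exact .inl ⟨j, hj, h⟩
    · exact .inr h
  · rintro (⟨j, hj, h⟩ | h)
    · exact ⟨j, hj.trans (Nat.lt_succ_self k), h⟩
    · exact ⟨k, Nat.lt_succ_self k, h⟩

theorem not_upDom_of_notMem {m k v : ℕ} (hG : IsGrowth U P m) (hk : k ≤ m) (hv : v ∉ seen U k)
    (x : ℕ → ℕ) : ¬ UpDom c U P k x v := by
  rintro ⟨j, hj, ⟨rfl, -⟩ | ⟨rfl, -⟩⟩
  · exact hv (mem_seen_of_lt hj)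
  · exact hv (hG.parent_mem hk hj)

theorem extend_congr {dI dE dB dI' dE' dB' : ℕ → ℕ} (d k : ℕ) (x : ℕ → ℕ)
    (h : ∀ j, k ≤ j → dI j = dI' j ∧ dE j = dE' j ∧ dB j = dB' j) :
    extend c U P dI dE dB d k x = extend c U P dI' dE' dB' d k x := by
  induction d generalizing k x with
  | zero => rfl
  | succ d ih =>
    obtain ⟨h1, h2, h3⟩ := h k le_rfl
    simp only [extend, choice, h1, h2, h3]
    exact ih _ _ fun j hj => h j (by omega)

section Merge

variable (c) (a e b : ℕ → ℕ) (u p : ℕ)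

/-- The cost of a leaf `u` outside the set when its neighbour `p` is in the set. -/
def leafOut : ℕ := if c u < c p then e u else b u

/-- The cost of `p` outside the set when its leaf `u` is in the set and no other neighbour
dominates `p`. -/
def headOut : ℕ := if c p < c u then e p else b p

/-- The three updated costs of `p`, each minimised over `u` inside or outside. With `p` outside, `p`
cannot dominate `u`, so an outside leaf costs `b u`. In `mergeDom` the vertex `p` is dominated by
what remains of the tree, so the state of `u` does not change its share `e p`. -/
def mergeIn : ℕ := a p + min (a u) (leafOut c e b u p)

def mergeDom : ℕ := e p + min (a u) (b u)

def mergeOut : ℕ := min (headOut c e b u p + a u) (b p + b u)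

end Merge

open Classical in
/-- Comparison of the costs before and after a leaf is merged into its neighbour. -/
theorem setCost_merge {m k : ℕ} (hG : IsGrowth U P m) (hk : k < m) (a e b : ℕ → ℕ)
    (x : ℕ → ℕ) :
    ∃ R,
      setCost c U P (Function.update a (P k) (mergeIn c a e b (U k) (P k)))
        (Function.update e (P k) (mergeDom a e b (U k) (P k)))
        (Function.update b (P k) (mergeOut c a e b (U k) (P k))) k x = R +
          (if 0 < x (P k) then mergeIn c a e b (U k) (P k)
            else if UpDom c U P k x (P k) then mergeDom a e b (U k) (P k)
            else mergeOut c a e b (U k) (P k)) ∧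
      ∀ y, (∀ v ∈ seen U k, y v = x v) → setCost c U P a e b (k + 1) y = R +
        (if 0 < x (P k) then a (P k) + (if 0 < y (U k) then a (U k) else leafOut c e b (U k) (P k))
          else (if UpDom c U P k x (P k) then e (P k) else
            if 0 < y (U k) then headOut c e b (U k) (P k) else b (P k)) +
              if 0 < y (U k) then a (U k) else b (U k)) := by
  obtain ⟨hp, hu⟩ := hG k hk
  have hne : U k ≠ P k := fun h => hu (h ▸ hp)
  -- The new edge can change domination only at its two ends, so `R` collects all seen vertices
  -- other than `P k`.
  refine ⟨∑ v ∈ (seen U k).erase (P k),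
    if 0 < x v then a v else if UpDom c U P k x v then e v else b v, ?_, fun y hy => ?_⟩
  · rw [setCost, ← Finset.sum_erase_add _ _ hp]
    congr 1
    · refine Finset.sum_congr rfl fun v hv => ?_
      simp [Function.update_of_ne (Finset.ne_of_mem_erase hv)]
    · simp
  · have hrest : ∀ v ∈ (seen U k).erase (P k),
        (if 0 < y v then a v else if UpDom c U P (k + 1) y v then e v else b v) =
          if 0 < x v then a v else if UpDom c U P k x v then e v else b v := by
      intro v hv
      have hv' := Finset.mem_of_mem_erase hv
      have hvu : v ≠ U k := fun h => hu (h ▸ hv')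
      have hvp := Finset.ne_of_mem_erase hv
      simp only [upDom_succ, hvu, hvp, false_and, or_false, hy v hv',
        upDom_congr hG hk.le hy v]
    rw [setCost, seen_succ, Finset.sum_insert hu, ← Finset.sum_erase_add _ _ hp,
      Finset.sum_congr rfl hrest]
    have h1 : UpDom c U P (k + 1) y (U k) ↔ 0 < x (P k) ∧ c (U k) < c (P k) := by
      simp [upDom_succ, not_upDom_of_notMem hG hk.le hu, hne, hy _ hp]
    have h2 : UpDom c U P (k + 1) y (P k) ↔
        UpDom c U P k x (P k) ∨ 0 < y (U k) ∧ c (P k) < c (U k) := by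
      simp [upDom_succ, hne.symm, upDom_congr hG hk.le hy]
    simp only [h1, h2, hy _ hp, leafOut, headOut]
    by_cases c1 : 0 < x (P k) <;> by_cases c2 : 0 < y (U k) <;>
      by_cases c3 : UpDom c U P k x (P k) <;> by_cases c4 : c (U k) < c (P k) <;>
      by_cases c5 : c (P k) < c (U k) <;> simp [c1, c2, c3, c4, c5] <;> omega

/-- The table entries record which state of the leaf attains each minimum, ties going to membership.
Extending by the recorded choice therefore attains the merged cost, while any other set pays one of
the two alternatives and so at least the minimum. -/
theorem Solves.merge {m k : ℕ} (hG : IsGrowth U P m) (hk : k < m) {a e b : ℕ → ℕ}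
    {dI dE dB : ℕ → ℕ} {full : (ℕ → ℕ) → ℕ}
    (hS : Solves c U P dI dE dB m full a e b (k + 1)) {i₁ i₂ i₃ : ℕ}
    (h₁ : 0 < i₁ ↔ a (U k) ≤ leafOut c e b (U k) (P k))
    (h₂ : 0 < i₂ ↔ a (U k) ≤ b (U k))
    (h₃ : 0 < i₃ ↔ headOut c e b (U k) (P k) + a (U k) ≤ b (P k) + b (U k)) :
    Solves c U P (Function.update dI k i₁) (Function.update dE k i₂) (Function.update dB k i₃)
      m full (Function.update a (P k) (mergeIn c a e b (U k) (P k)))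
      (Function.update e (P k) (mergeDom a e b (U k) (P k)))
      (Function.update b (P k) (mergeOut c a e b (U k) (P k))) k := by
  classical
  intro x
  obtain ⟨R, hR, hy⟩ := setCost_merge (c := c) hG hk a e b x
  obtain ⟨hp, hu⟩ := hG k hk
  constructor
  · obtain ⟨d, hd⟩ : ∃ d, m - k = d + 1 := ⟨m - k - 1, by omega⟩
    have hd' : m - (k + 1) = d := by omega
    -- Once `U k` is placed, only table entries of index above `k` are consulted, and the updates
    -- leave those alone.
    rw [hd, extend, extend_congr (dI' := dI) (dE' := dE) (dB' := dB)]
    · have := (hS (Function.update x (U k) (choice c U P (Function.update dI k i₁)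
        (Function.update dE k i₂) (Function.update dB k i₃) k x))).1
      rw [hd'] at this
      rw [this, hR, hy]
      · simp only [Function.update_self, choice, mergeIn, mergeDom, mergeOut]
        congr 1
        by_cases c1 : 0 < x (P k) <;> by_cases c2 : UpDom c U P k x (P k) <;>
          simp only [c1, c2, if_true, if_false, h₁, h₂, h₃] <;> split_ifs <;> omega
      · intro v hv
        rw [Function.update_of_ne]
        rintro rfl
        exact hu hv
    · intro j hj
      have : j ≠ k := by omega
      simp [this]
  · refine le_trans ?_ (hS x).2
    rw [hR, hy x fun _ _ => rfl]
    simp only [mergeIn, mergeDom, mergeOut]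
    gcongr
    split_ifs <;> omega

/-- Test sets: if all vertices are taken, `v` pays `a v`; if none is, nothing is dominated and `v`
pays `b v`. This is what limits the numbers stored by the program. -/
theorem Solves.bound {m k : ℕ} {a e b : ℕ → ℕ} {dI dE dB : ℕ → ℕ}
    {full : (ℕ → ℕ) → ℕ} (hS : Solves c U P dI dE dB m full a e b k) {B : ℕ}
    (hB : ∀ x, full x ≤ B) {v : ℕ} (hv : v ∈ seen U k) : a v ≤ B ∧ b v ≤ B := by
  classical
  constructor
  · have h := (hS fun _ => 1).2.trans (hB _)
    refine le_trans ?_ h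
    refine le_trans ?_ (Finset.single_le_sum (fun _ _ => Nat.zero_le _) hv)
    simp
  · have h := (hS fun _ => 0).2.trans (hB _)
    refine le_trans ?_ h
    refine le_trans ?_ (Finset.single_le_sum (fun _ _ => Nat.zero_le _) hv)
    simp [UpDom]

/-- Only the vertex `0` is left and no edge, so it cannot be dominated and the choice is between `a
0` and `b 0`. -/
theorem Solves.root {m : ℕ} {a e b : ℕ → ℕ} {dI dE dB : ℕ → ℕ}
    {full : (ℕ → ℕ) → ℕ} (hS : Solves c U P dI dE dB m full a e b 0) {i : ℕ}
    (hi : 0 < i ↔ a 0 ≤ b 0) (y : ℕ → ℕ) :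
    full (extend c U P dI dE dB m 0 (Function.update (fun _ => 0) 0 i)) ≤ full y := by
  classical
  refine le_trans ?_ (hS y).2
  have h0 := (hS (Function.update (fun _ => 0) 0 i)).1
  rw [Nat.sub_zero] at h0
  rw [h0]
  simp only [setCost, seen, UpDom, Finset.range_zero, Finset.image_empty, insert_empty_eq,
    Finset.sum_singleton, Function.update_self, hi, not_lt_zero, false_and, exists_false, if_false]
  split_ifs <;> omega

/-- Preserves `e ≤ b` under merging. The values `e`, which `Solves.bound` does not control, are
thereby bounded as well. -/
theorem mergeDom_le_mergeOut {a e b : ℕ → ℕ} {u p : ℕ} (h : e p ≤ b p) :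
    mergeDom a e b u p ≤ mergeOut c a e b u p := by
  simp only [mergeDom, mergeOut, headOut]
  split_ifs <;> omega

end Growth

/-! ### Trees on an initial segment of the natural numbers -/

section Tree

variable {n : ℕ} (T : SimpleGraph (Fin n)) (c : T.Coloring ℕ)

/-- Adjacency in `T`, for natural numbers. -/
def NatAdj (u v : ℕ) : Prop := ∃ (hu : u < n) (hv : v < n), T.Adj ⟨u, hu⟩ ⟨v, hv⟩

/-- The colour of a natural number. -/
def natColor (v : ℕ) : ℕ := if h : v < n then c ⟨v, h⟩ else 0

/-- A number exceeding the weights of all sets of vertices. -/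
def penalty : ℕ := 1 + ∑ v, c v

/-- The cost of taking a vertex into a set: its colour, or the penalty for the
colour `0`. -/
def inCost (v : ℕ) : ℕ := if 0 < natColor T c v then natColor T c v else penalty T c

/-- The cost of a set of vertices: its weight, and a penalty for every member of colour `0` and
every undominated vertex. -/
noncomputable def fullCost (U P : ℕ → ℕ) (x : ℕ → ℕ) : ℕ :=
  setCost (natColor T c) U P (inCost T c) (fun _ => 0) (fun _ => penalty T c) (n - 1) x

variable {T c}

theorem natColor_coe (v : Fin n) : natColor T c v = c v := by simp [natColor]

theorem NatAdj.symm {u v : ℕ} (h : NatAdj T u v) : NatAdj T v u := by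
  obtain ⟨hu, hv, h⟩ := h
  exact ⟨hv, hu, h.symm⟩

/-- Connectedness in the form in which it shows that the growth cannot get stuck. -/
theorem forall_of_natAdj_closed (hT : T.IsTree) {p : ℕ → Prop} (h0 : p 0)
    (hp : ∀ u v, NatAdj T u v → p u → p v) {v : ℕ} (hv : v < n) : p v := by
  have hn : 0 < n := by omega
  obtain ⟨w⟩ := hT.connected.preconnected ⟨0, hn⟩ ⟨v, hv⟩
  have key : ∀ {u v : Fin n}, T.Walk u v → p u → p v := by
    intro u v w
    induction w with
    | nil => exact id
    | cons h _ ih => exact fun hu => ih (hp _ _ ⟨_, _, h⟩ hu)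
  exact key w h0

/-- The steps of a growth order are edges of `T`. -/
def IsTreeGrowth (T : SimpleGraph (Fin n)) (U P : ℕ → ℕ) (m : ℕ) : Prop :=
  IsGrowth U P m ∧ ∀ k < m, NatAdj T (U k) (P k)

theorem IsTreeGrowth.seen_subset {U P : ℕ → ℕ} {m : ℕ} (hG : IsTreeGrowth T U P m) (hn : 0 < n) :
    seen U m ⊆ Finset.range n := by
  intro v hv
  rcases Finset.mem_insert.mp hv with rfl | hv
  · exact Finset.mem_range.mpr hn
  · obtain ⟨k, hk, rfl⟩ := Finset.mem_image.mp hv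
    exact Finset.mem_range.mpr (hG.2 k (Finset.mem_range.mp hk)).1

theorem IsTreeGrowth.lt {U P : ℕ → ℕ} {m : ℕ} (hG : IsTreeGrowth T U P m) (hn : 0 < n) : m < n := by
  have h := Finset.card_le_card (hG.seen_subset hn)
  rw [hG.1.card_seen, Finset.card_range] at h
  omega

theorem IsTreeGrowth.seen_eq {U P : ℕ → ℕ} (hG : IsTreeGrowth T U P (n - 1)) (hn : 0 < n) :
    seen U (n - 1) = Finset.range n :=
  Finset.eq_of_subset_of_card_le (hG.seen_subset hn) (by
    rw [hG.1.card_seen, Finset.card_range]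
    omega)

/-- A tree has `n - 1` edges and the growth uses `n - 1` distinct ones, hence all of them. -/
theorem IsTreeGrowth.natAdj_iff {U P : ℕ → ℕ} (hG : IsTreeGrowth T U P (n - 1)) (hT : T.IsTree)
    {u v : ℕ} :
    NatAdj T u v ↔ ∃ k < n - 1, (u = U k ∧ v = P k) ∨ (u = P k ∧ v = U k) := by
  classical
  constructor
  · rintro ⟨hu, hv, h⟩
    have hn : 0 < n := by omega
    let E : Finset (Sym2 ℕ) := T.edgeFinset.image (Sym2.map Fin.val)
    let F : Finset (Sym2 ℕ) := (Finset.range (n - 1)).image fun k => s(U k, P k)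
    have hFE : F ⊆ E := by
      intro z hz
      obtain ⟨k, hk, rfl⟩ := Finset.mem_image.mp hz
      obtain ⟨h1, h2, h3⟩ := hG.2 k (Finset.mem_range.mp hk)
      exact Finset.mem_image.mpr ⟨s(⟨U k, h1⟩, ⟨P k, h2⟩), by simpa using h3, rfl⟩
    -- `U k` is new at step `k`, so it is an end of no earlier edge.
    have hne : ∀ j k, j < k → k < n - 1 → s(U j, P j) ≠ s(U k, P k) := by
      intro j k hjk hk he
      have hU : U k ∈ s(U j, P j) := he ▸ Sym2.mem_mk_left _ _
      rcases Sym2.mem_iff.mp hU with h | h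
      · exact (hG.1 k hk).2 (h ▸ mem_seen_of_lt hjk)
      · exact (hG.1 k hk).2 (h ▸ hG.1.parent_mem hk.le hjk)
    have hF : F.card = n - 1 := by
      rw [Finset.card_image_of_injOn, Finset.card_range]
      intro j hj k hk he
      rcases lt_trichotomy j k with hlt | rfl | hlt
      · exact absurd he (hne j k hlt (by simpa using hk))
      · rfl
      · exact absurd he.symm (hne k j hlt (by simpa using hj))
    have hE : E.card ≤ n - 1 := by
      refine Finset.card_image_le.trans ?_
      have := hT.card_edgeFinset
      rw [Fintype.card_fin] at this
      omega
    have huv : s(u, v) ∈ F := by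
      rw [Finset.eq_of_subset_of_card_le hFE (by omega)]
      exact Finset.mem_image.mpr ⟨s(⟨u, hu⟩, ⟨v, hv⟩), by simpa using h, rfl⟩
    obtain ⟨k, hk, he⟩ := Finset.mem_image.mp huv
    refine ⟨k, Finset.mem_range.mp hk, ?_⟩
    rcases Sym2.eq_iff.mp he with ⟨h1, h2⟩ | ⟨h1, h2⟩
    · exact .inl ⟨h1.symm, h2.symm⟩
    · exact .inr ⟨h2.symm, h1.symm⟩
  · rintro ⟨k, hk, ⟨rfl, rfl⟩ | ⟨rfl, rfl⟩⟩
    · exact hG.2 k hk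
    · exact (hG.2 k hk).symm

theorem fullCost_le {U P : ℕ → ℕ} (hG : IsTreeGrowth T U P (n - 1)) (hn : 0 < n) (x : ℕ → ℕ) :
    fullCost T c U P x ≤ n * penalty T c := by
  classical
  rw [fullCost, setCost, hG.seen_eq hn]
  calc _ ≤ ∑ _v ∈ Finset.range n, penalty T c := Finset.sum_le_sum fun v hv => ?_
    _ = _ := by simp
  have hcol : natColor T c v ≤ penalty T c := by
    have hv' := Finset.mem_range.mp hv
    have := Finset.single_le_sum (f := fun v => c v) (fun _ _ => Nat.zero_le _)
      (Finset.mem_univ (⟨v, hv'⟩ : Fin n))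
    simp only [natColor, hv', dif_pos, penalty]
    omega
  simp only [inCost]
  split_ifs <;> omega

theorem fullCost_eq_sum {U P : ℕ → ℕ} (hG : IsTreeGrowth T U P (n - 1)) (hT : T.IsTree)
    (hn : 0 < n) (x : ℕ → ℕ) (D : Finset (Fin n)) (hD : ∀ v : Fin n, v ∈ D ↔ 0 < x v) :
    fullCost T c U P x = ∑ v : Fin n, open Classical in
      if v ∈ D then (if c v = 0 then penalty T c else c v)
      else if ∃ d ∈ D, T.Adj v d ∧ c v < c d then 0 else penalty T c := by
  classical
  rw [fullCost, setCost, hG.seen_eq hn, Finset.sum_range]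
  refine Finset.sum_congr rfl fun v _ => ?_
  have hdom : UpDom (natColor T c) U P (n - 1) x v ↔ ∃ d ∈ D, T.Adj v d ∧ c v < c d := by
    constructor
    · rintro ⟨k, hk, h⟩
      have h' : ∃ d, NatAdj T v d ∧ 0 < x d ∧ natColor T c v < natColor T c d := by
        rcases h with ⟨h1, h2, h3⟩ | ⟨h1, h2, h3⟩
        · exact ⟨P k, (hG.natAdj_iff hT).mpr ⟨k, hk, .inl ⟨h1, rfl⟩⟩, h2, h3⟩
        · exact ⟨U k, (hG.natAdj_iff hT).mpr ⟨k, hk, .inr ⟨h1, rfl⟩⟩, h2, h3⟩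
      obtain ⟨d, ⟨_, hd, hadj⟩, hx, hc⟩ := h'
      exact ⟨⟨d, hd⟩, (hD _).mpr hx, hadj,
        by simpa [natColor, hd] using hc⟩
    · rintro ⟨d, hd, hadj, hc⟩
      have hx := (hD d).mp hd
      rw [← natColor_coe, ← natColor_coe] at hc
      obtain ⟨k, hk, ⟨h1, h2⟩ | ⟨h1, h2⟩⟩ := (hG.natAdj_iff hT).mp ⟨v.2, d.2, hadj⟩
      · exact ⟨k, hk, .inl ⟨h1, h2 ▸ hx, h2 ▸ hc⟩⟩
      · exact ⟨k, hk, .inr ⟨h1, h2 ▸ hx, h2 ▸ hc⟩⟩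
  simp only [hD, hdom, inCost, natColor_coe, Nat.pos_iff_ne_zero, ne_eq, ite_not]

/-- A vertex of colour `0` has a neighbour by connectedness, and properness makes that neighbour's
colour positive. -/
theorem exists_isUpColorDominating (hT : T.IsTree) (hc : ∃ v, c v ≠ 0) :
    IsUpColorDominating T c (Finset.univ.filter fun v => c v ≠ 0) := by
  refine ⟨fun v hv => ?_, fun d hd => (Finset.mem_filter.mp hd).2⟩
  have hv0 : c v = 0 := by simpa using hv
  obtain ⟨w, hw⟩ := hc
  have hne : v ≠ w := fun h => hw (h ▸ hv0)
  have : Nontrivial (Fin n) := ⟨v, w, hne⟩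
  obtain ⟨d, hd⟩ := hT.connected.preconnected.exists_adj_of_nontrivial v
  have hcd : c d ≠ 0 := fun h => c.valid hd (by rw [hv0, h])
  exact ⟨d, by simpa using hcd, hd, by omega⟩

theorem isOmegaUCDominating_of_forall_fullCost_le {U P : ℕ → ℕ}
    (hG : IsTreeGrowth T U P (n - 1)) (hT : T.IsTree) (hn : 0 < n) (hc : ∃ v, c v ≠ 0)
    {x : ℕ → ℕ} (hx : ∀ y, fullCost T c U P x ≤ fullCost T c U P y) {D : Finset (Fin n)}
    (hD : ∀ v : Fin n, v ∈ D ↔ 0 < x v) : IsOmegaUCDominating T c D := by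
  classical
  have hdom : ∀ {D : Finset (Fin n)}, IsUpColorDominating T c D → ∀ {y : ℕ → ℕ},
      (∀ v : Fin n, v ∈ D ↔ 0 < y v) → fullCost T c U P y = weight T c D := by
    intro D hD y hy
    rw [fullCost_eq_sum hG hT hn y D hy, weight, ← Finset.sum_filter_add_sum_filter_not _ (· ∈ D)]
    have h1 : Finset.univ.filter (· ∈ D) = D := by ext; simp
    rw [h1, Finset.sum_congr rfl (g := fun v => c v), add_eq_left]
    · refine Finset.sum_eq_zero fun v hv => ?_
      have hv : v ∉ D := by simpa using hv
      rw [if_neg hv, if_pos (hD.1 v hv)]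
    · intro v hv
      rw [if_pos hv, if_neg (hD.2 v hv)]
  have hle : ∀ D', IsUpColorDominating T c D' → fullCost T c U P x ≤ weight T c D' := by
    intro D' hD'
    refine (hx fun v => if h : v < n then (if (⟨v, h⟩ : Fin n) ∈ D' then 1 else 0) else 0).trans_eq
      (hdom hD' fun v => ?_)
    by_cases hv : v ∈ D' <;> simp [hv]
  have hlt : fullCost T c U P x < penalty T c := by
    refine (hle _ (exists_isUpColorDominating hT hc)).trans_lt ?_
    have : weight T c (Finset.univ.filter fun v => c v ≠ 0) ≤ ∑ v, c v :=
      Finset.sum_le_sum_of_subset (Finset.filter_subset _ _)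
    simp only [penalty]
    omega
  -- The whole sum is below one penalty, so no single summand can be a penalty; this gives both
  -- domination conditions.
  have hterm : ∀ v : Fin n, (if v ∈ D then (if c v = 0 then penalty T c else c v)
      else if ∃ d ∈ D, T.Adj v d ∧ c v < c d then 0 else penalty T c) < penalty T c := by
    intro v
    refine lt_of_le_of_lt ?_ hlt
    rw [fullCost_eq_sum hG hT hn x D hD]
    exact Finset.single_le_sum (f := fun v : Fin n =>
      if v ∈ D then (if c v = 0 then penalty T c else c v)
      else if ∃ d ∈ D, T.Adj v d ∧ c v < c d then 0 else penalty T c)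
      (fun _ _ => Nat.zero_le _) (Finset.mem_univ v)
  have hDdom : IsUpColorDominating T c D := by
    constructor
    · intro v hv
      by_contra hcon
      have := hterm v
      rw [if_neg hv, if_neg hcon] at this
      exact lt_irrefl _ this
    · intro v hv h0
      have := hterm v
      rw [if_pos hv, if_pos h0] at this
      exact lt_irrefl _ this
  refine ⟨hDdom, le_antisymm ?_ (Nat.sInf_le ⟨D, hDdom, rfl⟩)⟩
  refine le_csInf ⟨_, D, hDdom, rfl⟩ ?_
  rintro w ⟨D', hD', rfl⟩
  rw [← hdom hDdom hD]
  exact hle D' hD'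

theorem IsEdgeList.length_eq {L : List (Fin n × Fin n)} (hL : IsEdgeList T L) (hT : T.IsTree) :
    L.length = n - 1 := by
  classical
  have h := hT.card_edgeFinset
  have h2 : (L.map fun e => s(e.1, e.2)).toFinset = T.edgeFinset := by
    ext x
    simpa using hL.2 x
  rw [← h2, List.toFinset_card_of_nodup hL.1, List.length_map, Fintype.card_fin] at h
  omega

end Tree

/-! ### Positions of the input words -/

section Input

variable {n : ℕ} (c : Fin n → ℕ) (L : List (Fin n × Fin n))

theorem inputWords_zero : (inputWords c L).getD 0 0 = n := rfl

theorem inputWords_color (v : Fin n) : (inputWords c L).getD (v + 1) 0 = c v := by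
  simp [inputWords, List.getD_eq_getElem?_getD, List.getElem?_append_left]

theorem length_inputWords : (inputWords c L).length = n + 1 + 2 * L.length := by
  simp [inputWords, List.length_flatMap]
  omega

theorem inputWords_edge (j : ℕ) (hj : j < L.length) :
    (inputWords c L).getD (n + 1 + 2 * j) 0 = (L[j].1 : ℕ) ∧
      (inputWords c L).getD (n + 1 + 2 * j + 1) 0 = (L[j].2 : ℕ) := by
  have key : ∀ (L : List (Fin n × Fin n)) (j : ℕ) (hj : j < L.length),
      (L.flatMap fun e => [(e.1 : ℕ), (e.2 : ℕ)])[2 * j]? = some (L[j].1 : ℕ) ∧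
      (L.flatMap fun e => [(e.1 : ℕ), (e.2 : ℕ)])[2 * j + 1]? = some (L[j].2 : ℕ) := by
    intro L
    induction L with
    | nil => intro j hj; simp at hj
    | cons e L ih =>
      intro j hj
      cases j with
      | zero => simp
      | succ j => simpa [mul_add] using ih j (by simpa using hj)
  obtain ⟨h1, h2⟩ := key L j hj
  have e1 : n + 1 + 2 * j = (n + 2 * j) + 1 := by ring
  have e2 : n + 1 + 2 * j + 1 = (n + (2 * j + 1)) + 1 := by ring
  constructor
  · rw [e1]
    simp [inputWords, List.getD_eq_getElem?_getD, List.getElem?_append_right, h1]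
  · rw [e2]
    simp [inputWords, List.getD_eq_getElem?_getD, List.getElem?_append_right, h2]

end Input

/-! ### The program -/

namespace Cmd

def skip : Cmd := copy 8 8

/-- The registers `0`, `1`, `2`, `3` get the values `0`, `1`, `n`, `n - 1`. -/
def setup : Cmd :=
  seq (const 1 1) (seq (load 2 0 0) (sub 3 2 1))

/-- Array `14` gets the colours, and register `4` gets the penalty. -/
def readColors : Cmd :=
  seq (forUp 5 2 (seq (add 8 5 1) (seq (load 8 0 8) (seq (store 14 5 8) (add 4 4 8))))) (add 4 4 1)

/-- The arrays `4` and `6` get the initial costs. -/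
def initCosts : Cmd :=
  forUp 5 2 (seq (load 8 14 5) (seq (ifLt 0 8 (store 4 5 8) (store 4 5 4)) (store 6 5 4)))

/-- The arrays `12` and `13` get the ends of the edges. -/
def readEdges : Cmd :=
  seq (add 7 2 1) (forUp 6 3 (seq (load 8 0 7) (seq (store 12 6 8) (seq (add 7 7 1)
    (seq (load 8 0 7) (seq (store 13 6 8) (add 7 7 1)))))))

/-- Append a step to the growth order. -/
def attach (u p : ℕ) : Cmd :=
  seq (store 2 7 u) (seq (store 3 7 p) (seq (store 1 u 1) (add 7 7 1)))

/-- If exactly one end of edge number `R[6]` has been seen, attach the other end. -/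
def visit : Cmd :=
  seq (load 8 12 6) (seq (load 9 13 6) (seq (load 10 1 8) (seq (load 11 1 9)
    (ifLt 10 11 (attach 8 9) (ifLt 11 10 (attach 9 8) skip)))))

/-- The arrays `2` and `3` get a growth order. Array `1` marks the vertices seen. -/
def grow : Cmd :=
  seq (store 1 0 1) (seq (const 7 0) (forUp 5 2 (forUp 6 3 visit)))

/-- With `u` and `p` in the registers `8` and `9`, the pairs `10, 11`, `12, 13`, `14, 15`, `16, 17`
receive their values of `a`, `e`, `b` and the colour. -/
def fetch : Cmd :=
  seq (load 8 2 5) (seq (load 9 3 5) (seq (load 10 4 8) (seq (load 11 4 9) (seq (load 12 5 8)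
    (seq (load 13 5 9) (seq (load 14 6 8) (seq (load 15 6 9) (seq (load 16 14 8)
      (load 17 14 9)))))))))

/-- Register `18` becomes `leafOut`, `19` becomes `headOut` plus `a u`, and `15` becomes `b p + b
u`. -/
def candidates : Cmd :=
  seq (ifLt 16 17 (copy 18 12) (copy 18 14)) (seq (ifLt 17 16 (copy 19 13) (copy 19 15))
    (seq (add 19 19 10) (add 15 15 14)))

/-- Truncated subtraction replaces comparisons: `x - (x - y)` is the minimum, and `1 - (x - y)` is
the bit telling whether `x ≤ y`. -/
def minimize : Cmd :=
  seq (seq (sub 20 10 18) (seq (sub 21 1 20) (seq (store 7 5 21) (seq (sub 20 10 20)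
    (seq (add 11 11 20) (store 4 9 11)))))) (seq
  (seq (sub 20 10 14) (seq (sub 21 1 20) (seq (store 8 5 21) (seq (sub 20 10 20)
    (seq (add 13 13 20) (store 5 9 13))))))
  (seq (sub 20 19 15) (seq (sub 21 1 20) (seq (store 9 5 21) (seq (sub 20 19 20)
    (store 6 9 20))))))

/-- Merge the leaves into their neighbours, in reverse order. The costs stand in the arrays `4`,
`5`, `6`, and the tables in the arrays `7`, `8`, `9`. -/
def mergeAll : Cmd :=
  seq (copy 5 3) (whileLt 0 5 (seq (sub 5 5 1) (seq fetch (seq candidates minimize))))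

def chooseRoot : Cmd :=
  seq (load 8 4 0) (seq (load 9 6 0) (seq (sub 8 8 9) (seq (sub 8 1 8) (store 10 0 8))))

def chooseNext : Cmd :=
  seq (load 8 2 5) (seq (load 9 3 5) (seq (load 10 10 9) (seq (load 11 11 9)
    (seq (ifLt 0 10 (load 12 7 5) (ifLt 0 11 (load 12 8 5) (load 12 9 5))) (store 10 8 12)))))

/-- An edge is examined once, when its later end has just been decided; at that time the memberships
of both ends are known. -/
def markDominated : Cmd :=
  seq (load 16 14 8) (seq (load 17 14 9) (seq
    (ifLt 16 17 (ifLt 0 10 (store 11 8 1) skip) skip)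
    (ifLt 17 16 (ifLt 0 12 (store 11 9 1) skip) skip)))

/-- Array `10` gets the characteristic vector of the set. Array `11` marks the dominated
vertices. -/
def assign : Cmd :=
  seq chooseRoot (forUp 5 3 (seq chooseNext markDominated))

def output : Cmd :=
  forUp 5 2 (seq (load 8 10 5) (store 0 5 8))

def main : Cmd :=
  seq (seq setup readColors) (seq initCosts (seq readEdges (seq grow (seq mergeAll
    (seq assign output)))))

end Cmd

open Cmd

/-! ### Correctness of reading the input and setting the initial costs -/

section Phases

variable {n : ℕ} (T : SimpleGraph (Fin n)) (c : T.Coloring ℕ)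

/-- The registers for constants have their values. -/
structure Base (n M : ℕ) (h : AState) : Prop where
  zero : h.reg 0 = 0
  one : h.reg 1 = 1
  size : h.reg 2 = n
  pred : h.reg 3 = n - 1
  pen : h.reg 4 = M

theorem Base.setReg {n M : ℕ} {h : AState} (hB : Base n M h) (r x : ℕ) (hr : 4 < r) :
    Base n M (h.setReg r x) := by
  obtain ⟨h0, h1, h2, h3, h4⟩ := hB
  constructor <;> rw [AState.reg_setReg, if_neg (by omega)] <;> assumption

/-- The state after the colours have been read. -/
structure ColorsRead (w : ℕ → ℕ) (h : AState) : Prop where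
  base : Base n (penalty T c) h
  input : h.arr 0 = w
  color : h.arr 14 = natColor T c
  rest : ∀ k, k ≠ 0 → k ≠ 14 → h.arr k = fun _ => 0

theorem sum_natColor : ∑ v ∈ Finset.range n, natColor T c v = ∑ v, c v := by
  rw [Finset.sum_range]
  exact Finset.sum_congr rfl fun v _ => natColor_coe v

theorem sum_natColor_lt (k : ℕ) (hk : k ≤ n) :
    ∑ v ∈ Finset.range k, natColor T c v < penalty T c := by
  have := Finset.sum_le_sum_of_subset (f := natColor T c) (Finset.range_mono hk)
  rw [sum_natColor] at this
  simp only [penalty]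
  omega

theorem wp_readColors {W : ℕ} (hn : 0 < n) (hW : 45 * (n * penalty T c) ≤ W) {w : ℕ → ℕ}
    (hw0 : w 0 = n) (hw : ∀ v < n, w (v + 1) = natColor T c v) {h : AState}
    (hr : ∀ r, h.reg r = 0) (h0 : h.arr 0 = w) (hk : ∀ k, k ≠ 0 → h.arr k = fun _ => 0) :
    wp n W 15 (seq setup readColors) (ColorsRead T c w) h := by
  have hM : 0 < penalty T c := by simp [penalty]
  have hW1 : penalty T c ≤ W := by nlinarith
  have hW2 : 45 * n ≤ W := by nlinarith
  simp only [wp, setup, readColors]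
  refine ⟨by omega, ⟨by omega, by simp [hr]; omega⟩, ?_⟩
  -- During the loop the penalty register holds the partial sum of colours; the final `+ 1` is added
  -- afterwards.
  refine wp_forUp n le_rfl (by omega) (fun k g => Base n (∑ v ∈ Finset.range k, natColor T c v) g ∧
    g.reg 5 = k ∧ g.arr 0 = w ∧ (∀ v, g.arr 14 v = if v < k then natColor T c v else 0) ∧
    ∀ k, k ≠ 0 → k ≠ 14 → g.arr k = fun _ => 0) ?_ ?_ ?_ ?_
  · refine ⟨?_, ?_, ?_, ?_, ?_⟩
    · constructor <;> simp [hr, h0, hw0]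
    · simp
    · simpa using h0
    · simp [hk]
    · intro k h0 _
      simpa using hk k h0
  · rintro k g ⟨hB, h5, -⟩
    exact ⟨h5, hB.size⟩
  · rintro k hkn g ⟨hB, h5, hg0, hg14, hgr⟩
    have hlt := sum_natColor_lt T c (k + 1) hkn
    rw [Finset.sum_range_succ] at hlt
    obtain ⟨b0, b1, b2, b3, b4⟩ := hB
    simp only [wp]
    refine ⟨by omega, ⟨by omega, by simp [h5, b1]; omega⟩, ⟨by omega, by simp [h5]; omega⟩, ?_, ?_⟩
    · simp [h5, b1, b4, hg0, hw k hkn]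
      omega
    · refine ⟨by simpa using b1, by simpa using h5, ?_, ?_, ?_, ?_, ?_⟩
      · constructor <;> simp [b0, b1, b2, b3, b4, h5, hg0, hw k hkn, Finset.sum_range_succ]
      · simp
      · simpa using hg0
      · intro v
        simp only [AState.arr_setReg, AState.arr_setArr, AState.reg_setReg, h5, b1, hg0]
        rcases lt_trichotomy v k with hv | rfl | hv
        · simp [hv.ne, hg14, hv, Nat.lt_succ_of_lt hv]
        · simp [hw v hkn]
        · have : ¬ v < k + 1 := by omega
          simp [hv.ne', hg14, hv.not_gt, this]
      · intro a ha ha'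
        simpa [ha'] using hgr a ha ha'
  · rintro g ⟨hB, h5, hg0, hg14, hgr⟩
    obtain ⟨b0, b1, b2, b3, b4⟩ := hB
    rw [sum_natColor] at b4
    have hp : ∑ v, c v + 1 = penalty T c := by simp [penalty, add_comm]
    refine ⟨by rw [b4, b1, hp]; exact hW1, ?_, ?_, ?_, ?_⟩
    · constructor <;> simp [b0, b1, b2, b3, b4, hp]
    · simpa using hg0
    · funext v
      by_cases hv : v < n <;> simp [hg14, natColor, hv]
    · intro a ha ha'
      simpa using hgr a ha ha'

/-- The state before the edges are read. -/
structure CostsReady (w : ℕ → ℕ) (h : AState) : Prop where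
  base : Base n (penalty T c) h
  input : h.arr 0 = w
  color : h.arr 14 = natColor T c
  inC : ∀ v < n, h.arr 4 v = inCost T c v
  outC : ∀ v < n, h.arr 6 v = penalty T c
  -- Arrays that later phases need in their zero state: seen marks, the costs `e`, the chosen set,
  -- and the domination marks.
  rest : ∀ k ∈ ({1, 5, 10, 11} : Finset ℕ), h.arr k = fun _ => 0

theorem wp_initCosts {W : ℕ} (hn : 0 < n) (hW : 45 * (n * penalty T c) ≤ W) {w : ℕ → ℕ}
    {h : AState} (hh : ColorsRead T c w h) : wp n W 15 initCosts (CostsReady T c w) h := by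
  have hM : 0 < penalty T c := by simp [penalty]
  have hW2 : 45 * n ≤ W := by nlinarith
  refine wp_forUp n le_rfl (by omega) (fun k g => Base n (penalty T c) g ∧
    g.reg 5 = k ∧ g.arr 0 = w ∧ g.arr 14 = natColor T c ∧ (∀ v < k, g.arr 4 v = inCost T c v) ∧
    (∀ v < k, g.arr 6 v = penalty T c) ∧
    ∀ k ∈ ({1, 5, 10, 11} : Finset ℕ), g.arr k = fun _ => 0) ?_ ?_ ?_ ?_
  · refine ⟨hh.base.setReg _ _ (by omega), by simp, hh.input, hh.color, by simp, by simp, ?_⟩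
    intro k hk
    simp only [Finset.mem_insert, Finset.mem_singleton] at hk
    exact hh.rest k (by omega) (by omega)
  · rintro k g ⟨hB, h5, -⟩
    exact ⟨h5, hB.size⟩
  · rintro k hkn g ⟨⟨b0, b1, b2, b3, b4⟩, h5, hg0, hg14, hg4, hg6, hgr⟩
    have hup : ∀ (f F : ℕ → ℕ), (∀ v < k, f v = F v) → ∀ x, x = F k →
        ∀ v < k + 1, Function.update f k x v = F v := by
      intro f F hf x hx v hv
      rcases Nat.lt_succ_iff_lt_or_eq.mp hv with hv | rfl
      · rw [Function.update_of_ne hv.ne, hf v hv]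
      · rw [Function.update_self, hx]
    simp only [wp, AState.reg_setReg, AState.reg_setArr, AState.arr_setReg, AState.arr_setArr,
      b0, b1, b4, h5, hg14, ↓reduceIte, Nat.reduceEqDiff, OfNat.zero_ne_ofNat,
      OfNat.one_ne_ofNat]
    refine ⟨by omega, fun hlt => ⟨by omega, by omega, ?_⟩, fun hlt => ⟨by omega, by omega, ?_⟩⟩
    all_goals
      refine ⟨by simp, by simp, ?_, by simp, by simpa using hg0, by simp, ?_, ?_, ?_⟩
      · constructor <;> simp [b0, b1, b2, b3, b4]
      · refine hup _ (inCost T c) hg4 _ ?_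
        simp [inCost, hlt]
      · exact hup _ (fun _ => penalty T c) hg6 _ rfl
      · intro a ha
        have := hgr a ha
        simp only [Finset.mem_insert, Finset.mem_singleton] at ha
        rcases ha with rfl | rfl | rfl | rfl <;> simpa using this
  · rintro g ⟨hB, h5, hg0, hg14, hg4, hg6, hgr⟩
    exact ⟨hB, hg0, hg14, hg4, hg6, hgr⟩

/-- The state before a growth order is computed. -/
structure EdgesReady (x y : ℕ → ℕ) (h : AState) : Prop where
  base : Base n (penalty T c) h
  color : h.arr 14 = natColor T c
  inC : ∀ v < n, h.arr 4 v = inCost T c v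
  outC : ∀ v < n, h.arr 6 v = penalty T c
  rest : ∀ k ∈ ({1, 5, 10, 11} : Finset ℕ), h.arr k = fun _ => 0
  fst : ∀ j < n - 1, h.arr 12 j = x j
  snd : ∀ j < n - 1, h.arr 13 j = y j

theorem wp_readEdges {W : ℕ} (hn : 0 < n) (hW : 45 * (n * penalty T c) ≤ W) {w x y : ℕ → ℕ}
    (hx : ∀ j < n - 1, w (n + 1 + 2 * j) = x j) (hy : ∀ j < n - 1, w (n + 1 + 2 * j + 1) = y j)
    {h : AState} (hh : CostsReady T c w h) : wp n W 15 readEdges (EdgesReady T c x y) h := by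
  have hM : 0 < penalty T c := by simp [penalty]
  have hW2 : 45 * n ≤ W := by nlinarith
  obtain ⟨⟨b0, b1, b2, b3, b4⟩, hh0, hh14, hh4, hh6, hhr⟩ := hh
  simp only [wp, readEdges]
  refine ⟨by omega, ?_⟩
  refine wp_forUp (n - 1) (by omega) (by omega) (fun k g => Base n (penalty T c) g ∧
    g.reg 6 = k ∧ g.reg 7 = n + 1 + 2 * k ∧ g.arr 0 = w ∧ g.arr 14 = natColor T c ∧
    (∀ v < n, g.arr 4 v = inCost T c v) ∧ (∀ v < n, g.arr 6 v = penalty T c) ∧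
    (∀ k ∈ ({1, 5, 10, 11} : Finset ℕ), g.arr k = fun _ => 0) ∧
    (∀ j < k, g.arr 12 j = x j) ∧ ∀ j < k, g.arr 13 j = y j) ?_ ?_ ?_ ?_
  · refine ⟨?_, by simp, by simp [b1, b2], hh0, hh14, hh4, hh6, hhr, by simp, by simp⟩
    constructor <;> simp [b0, b1, b2, b3, b4]
  · rintro k g ⟨hB, h6, -⟩
    exact ⟨h6, hB.pred⟩
  · rintro k hkn g ⟨⟨b0, b1, b2, b3, b4⟩, h6, h7, hg0, hg14, hg4, hg6, hgr, hg12, hg13⟩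
    have hup : ∀ (f F : ℕ → ℕ), (∀ v < k, f v = F v) →
        ∀ v < k + 1, Function.update f k (F k) v = F v := by
      intro f F hf v hv
      rcases Nat.lt_succ_iff_lt_or_eq.mp hv with hv | rfl
      · rw [Function.update_of_ne hv.ne, hf v hv]
      · rw [Function.update_self]
    simp only [wp, AState.reg_setReg, AState.reg_setArr, AState.arr_setReg, AState.arr_setArr,
      b1, h6, h7, hg0, ↓reduceIte, Nat.reduceEqDiff, OfNat.zero_ne_ofNat,
      OfNat.one_ne_ofNat]
    refine ⟨by omega, by omega, by omega, by omega, by omega, by omega,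
      by simp, by simp, ?_, by simp, by omega, by simp,
      by simpa using hg14, by simpa using hg4, by simpa using hg6, ?_, ?_, ?_⟩
    · constructor <;> simp [b0, b1, b2, b3, b4]
    · intro a ha
      have := hgr a ha
      simp only [Finset.mem_insert, Finset.mem_singleton] at ha
      rcases ha with rfl | rfl | rfl | rfl <;> simpa using this
    · simpa [hx k hkn] using hup _ x hg12
    · simpa [hy k hkn] using hup _ y hg13
  · rintro g ⟨hB, h6, h7, hg0, hg14, hg4, hg6, hgr, hg12, hg13⟩
    exact ⟨hB, hg14, hg4, hg6, hgr, hg12, hg13⟩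

end Phases

/-! ### Computing a growth order from the edge list -/

section Grow

variable {n : ℕ} (T : SimpleGraph (Fin n)) (c : T.Coloring ℕ)

theorem seen_congr {U U' : ℕ → ℕ} {k : ℕ} (h : ∀ j < k, U j = U' j) : seen U k = seen U' k := by
  rw [seen, seen, Finset.image_congr]
  exact fun j hj => h j (by simpa using hj)

theorem seen_update (U : ℕ → ℕ) (k u : ℕ) :
    seen (Function.update U k u) (k + 1) = insert u (seen U k) := by
  rw [seen_succ, Function.update_self,
    seen_congr fun j hj => Function.update_of_ne (ne_of_lt hj) u U]

theorem IsTreeGrowth.attach {T : SimpleGraph (Fin n)} {U P : ℕ → ℕ} {k u p : ℕ}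
    (hG : IsTreeGrowth T U P k)
    (hp : p ∈ seen U k) (hu : u ∉ seen U k) (h : NatAdj T u p) :
    IsTreeGrowth T (Function.update U k u) (Function.update P k p) (k + 1) := by
  have hseen : ∀ j ≤ k, seen (Function.update U k u) j = seen U j := fun j hj =>
    seen_congr fun i hi => Function.update_of_ne (ne_of_lt (hi.trans_le hj)) u U
  refine ⟨fun j hj => ?_, fun j hj => ?_⟩
  · rw [hseen j (Nat.lt_succ_iff.mp hj)]
    rcases Nat.lt_succ_iff_lt_or_eq.mp hj with hj | rfl
    · simpa [hj.ne] using hG.1 j hj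
    · simpa using ⟨hp, hu⟩
  · rcases Nat.lt_succ_iff_lt_or_eq.mp hj with hj | rfl
    · simpa [hj.ne] using hG.2 j hj
    · simpa using h

/-- The state while the growth order is computed. -/
structure Growing (x y : ℕ → ℕ) (h : AState) : Prop where
  base : Base n (penalty T c) h
  color : h.arr 14 = natColor T c
  inC : ∀ v < n, h.arr 4 v = inCost T c v
  outC : ∀ v < n, h.arr 6 v = penalty T c
  rest : ∀ k ∈ ({5, 10, 11} : Finset ℕ), h.arr k = fun _ => 0
  fst : ∀ j < n - 1, h.arr 12 j = x j
  snd : ∀ j < n - 1, h.arr 13 j = y j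
  growth : IsTreeGrowth T (h.arr 2) (h.arr 3) (h.reg 7)
  mark : h.arr 1 = fun v => if v ∈ seen (h.arr 2) (h.reg 7) then 1 else 0

variable {T c}

theorem Growing.setReg {x y : ℕ → ℕ} {h : AState} (hh : Growing T c x y h) (r z : ℕ) (hr : 4 < r)
    (hr7 : r ≠ 7) : Growing T c x y (h.setReg r z) := by
  obtain ⟨h1, h2, h3, h4, h5, h6, h7, h8, h9⟩ := hh
  have e : (h.setReg r z).reg 7 = h.reg 7 := by simp [hr7.symm]
  exact ⟨h1.setReg r z hr, h2, h3, h4, h5, h6, h7, by rw [e]; exact h8, by rw [e]; exact h9⟩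

theorem wp_attach {W : ℕ} (hn : 0 < n) (hW : 45 * n ≤ W) {x y : ℕ → ℕ} {r s : ℕ}
    {h : AState} (hh : Growing T c x y h) (hp : h.reg s ∈ seen (h.arr 2) (h.reg 7))
    (hu : h.reg r ∉ seen (h.arr 2) (h.reg 7)) (hadj : NatAdj T (h.reg r) (h.reg s)) :
    wp n W 15 (attach r s) (fun g => Growing T c x y g ∧ g.reg 7 = h.reg 7 + 1 ∧
      g.reg 5 = h.reg 5 ∧ g.reg 6 = h.reg 6) h := by
  obtain ⟨⟨b0, b1, b2, b3, b4⟩, h2, h3, h4, h5, h6, h7, h8, h9⟩ := hh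
  have hlt := h8.lt hn
  have hru : h.reg r < n := hadj.1
  have hG := h8.attach hp hu hadj
  simp only [wp, attach, AState.reg_setReg, AState.reg_setArr, b1]
  refine ⟨by omega, by omega, by omega, by omega, ?_, by simp, by simp, by simp⟩
  constructor
  · constructor <;> simp [b0, b1, b2, b3, b4]
  · simpa using h2
  · simpa using h3
  · simpa using h4
  · intro k hk
    have := h5 k hk
    simp only [Finset.mem_insert, Finset.mem_singleton] at hk
    rcases hk with rfl | rfl | rfl <;> simpa using this
  · simpa using h6
  · simpa using h7
  · simpa using hG
  · funext v
    simp only [AState.reg_setReg, AState.arr_setReg, AState.arr_setArr,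
      ↓reduceIte, Nat.reduceEqDiff, OfNat.one_ne_ofNat, OfNat.ofNat_ne_one, seen_update, h9,
      Finset.mem_insert]
    by_cases hv : v = h.reg r <;> simp [hv]

/-- The final alternative measures progress: either a vertex is attached, or the edge does not leave
the seen set. -/
theorem wp_visit {W : ℕ} (hn : 0 < n) (hW : 45 * n ≤ W) {x y : ℕ → ℕ} {j : ℕ} (hj : j < n - 1)
    (hxy : NatAdj T (x j) (y j)) {h : AState} (hh : Growing T c x y h) (h6 : h.reg 6 = j) :
    wp n W 15 visit (fun g => Growing T c x y g ∧ g.reg 5 = h.reg 5 ∧ g.reg 6 = j ∧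
      (g.reg 7 = h.reg 7 + 1 ∨ g.reg 7 = h.reg 7 ∧ g.arr 2 = h.arr 2 ∧
        (x j ∈ seen (h.arr 2) (h.reg 7) ↔ y j ∈ seen (h.arr 2) (h.reg 7)))) h := by
  have hx := hh.fst j hj
  have hy := hh.snd j hj
  have hm := hh.mark
  have hxn : x j < n := hxy.1
  have hyn : y j < n := hxy.2.1
  simp only [wp, visit, AState.reg_setReg, AState.arr_setReg, h6, ↓reduceIte, Nat.reduceEqDiff,
    hx, hy]
  refine ⟨by omega, by omega, by omega, by omega, fun hlt => ?_, fun hlt => ⟨fun hlt' => ?_,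
    fun hlt' => ?_⟩⟩
  · rw [hm] at hlt
    have hxs : x j ∉ seen (h.arr 2) (h.reg 7) := fun hc => by
      simp [hc] at hlt
      split_ifs at hlt <;> omega
    have hys : y j ∈ seen (h.arr 2) (h.reg 7) := by by_contra hc; simp [hc] at hlt
    refine wp_mono _ ?_ (wp_attach hn hW ((((hh.setReg 8 _ (by omega)
      (by omega)).setReg 9 _ (by omega) (by omega)).setReg 10 _ (by omega) (by omega)).setReg 11 _
      (by omega) (by omega)) (by simpa using hys) (by simpa using hxs) (by simpa using hxy))
    rintro g ⟨hg, h7', h5', h6'⟩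
    exact ⟨hg, by simpa using h5', by simpa [h6] using h6', .inl (by simpa using h7')⟩
  · rw [hm] at hlt'
    have hys : y j ∉ seen (h.arr 2) (h.reg 7) := fun hc => by
      simp [hc] at hlt'
      split_ifs at hlt' <;> omega
    have hxs : x j ∈ seen (h.arr 2) (h.reg 7) := by by_contra hc; simp [hc] at hlt'
    refine wp_mono _ ?_ (wp_attach hn hW ((((hh.setReg 8 _ (by omega)
      (by omega)).setReg 9 _ (by omega) (by omega)).setReg 10 _ (by omega) (by omega)).setReg 11 _
      (by omega) (by omega)) (by simpa using hxs) (by simpa using hys) (by simpa using hxy.symm))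
    rintro g ⟨hg, h7', h5', h6'⟩
    exact ⟨hg, by simpa using h5', by simpa [h6] using h6', .inl (by simpa using h7')⟩
  · refine ⟨((((hh.setReg 8 _ (by omega)
      (by omega)).setReg 9 _ (by omega) (by omega)).setReg 10 _ (by omega) (by omega)).setReg 11 _
      (by omega) (by omega)).setReg 8 _ (by omega) (by omega), by simp, by simpa using h6,
      .inr ⟨by simp, rfl, ?_⟩⟩
    rw [hm] at hlt hlt'
    by_cases hxs : x j ∈ seen (h.arr 2) (h.reg 7) <;>
      by_cases hys : y j ∈ seen (h.arr 2) (h.reg 7) <;> simp [hxs, hys] at hlt hlt' ⊢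

theorem wp_grow {W : ℕ} (hT : T.IsTree) (hn : 0 < n) (hW : 45 * n ≤ W) {x y : ℕ → ℕ}
    (hxy : ∀ j < n - 1, NatAdj T (x j) (y j))
    (hadj : ∀ u v, NatAdj T u v → ∃ j < n - 1, (u = x j ∧ v = y j) ∨ (u = y j ∧ v = x j))
    {h : AState} (hh : EdgesReady T c x y h) :
    wp n W 15 grow (fun g => Growing T c x y g ∧ g.reg 7 = n - 1) h := by
  obtain ⟨⟨b0, b1, b2, b3, b4⟩, hh14, hh4, hh6, hhr, hh12, hh13⟩ := hh
  simp only [wp, grow]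
  refine ⟨by omega, by omega, ?_⟩
  -- Each pass attaches at least one vertex until all are seen, so `n` passes suffice for `n - 1`
  -- steps.
  refine wp_forUp n le_rfl (by omega) (fun k g => Growing T c x y g ∧ g.reg 5 = k ∧
    min k (n - 1) ≤ g.reg 7) ?_ ?_ ?_ ?_
  · refine ⟨?_, by simp, by simp⟩
    constructor
    · constructor <;> simp [b0, b1, b2, b3, b4]
    · simpa using hh14
    · simpa using hh4
    · simpa using hh6
    · intro k hk
      have := hhr k (Finset.mem_insert_of_mem hk)
      simp only [Finset.mem_insert, Finset.mem_singleton] at hk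
      rcases hk with rfl | rfl | rfl <;> simpa using this
    · simpa using hh12
    · simpa using hh13
    · exact ⟨fun k hk => by simp at hk, fun k hk => by simp at hk⟩
    · funext v
      simp [seen, hhr 1 (by simp), b0, b1, Function.update_apply]
  · rintro k g ⟨hg, h5, -⟩
    exact ⟨h5, hg.base.size⟩
  · rintro k hk h₀ ⟨hh₀, h5, hmin⟩
    -- If the count is unchanged since the start of the pass, nothing was attached in between, so
    -- all edges visited so far respect the same seen set.
    refine wp_forUp (n - 1) (by omega) (by omega) (fun j g => Growing T c x y g ∧ g.reg 5 = k ∧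
      g.reg 6 = j ∧ h₀.reg 7 ≤ g.reg 7 ∧ (g.reg 7 = h₀.reg 7 → ∀ i < j,
        (x i ∈ seen (g.arr 2) (g.reg 7) ↔ y i ∈ seen (g.arr 2) (g.reg 7)))) ?_ ?_ ?_ ?_
    · exact ⟨hh₀.setReg _ _ (by omega) (by omega), by simpa using h5, by simp, by simp, by simp⟩
    · rintro j g ⟨hg, -, h6, -⟩
      exact ⟨h6, hg.base.pred⟩
    · rintro j hj g ⟨hg, h5, h6, hle, hsame⟩
      refine wp_mono _ ?_ (wp_visit hn hW hj (hxy j hj) hg h6)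
      rintro g' ⟨hg', h5', h6', hor⟩
      refine ⟨hg'.base.one, h6', hg'.setReg _ _ (by omega) (by omega), by simp [h5', h5], by simp,
        ?_, ?_⟩
      · simp only [AState.reg_setReg, Nat.reduceEqDiff, ↓reduceIte]
        omega
      · simp only [AState.reg_setReg, Nat.reduceEqDiff, ↓reduceIte, AState.arr_setReg]
        intro h7 i hi
        rcases hor with hor | ⟨h7', ha, hiff⟩
        · omega
        · rw [h7', ha]
          rcases Nat.lt_succ_iff_lt_or_eq.mp hi with hi | rfl
          · exact hsame (by omega) i hi
          · exact hiff
    · rintro g ⟨hg, h5, h6, hle, hsame⟩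
      refine ⟨hg.base.one, h5, hg.setReg _ _ (by omega) (by omega), by simp, ?_⟩
      simp only [AState.reg_setReg, Nat.reduceEqDiff, ↓reduceIte]
      rcases hle.lt_or_eq with hlt | heq
      · omega
      -- An idle pass shows that the seen set is closed under adjacency; it contains `0`, hence
      -- every vertex.
      · have hall : Finset.range n ⊆ seen (g.arr 2) (g.reg 7) := by
          intro v hv
          refine forall_of_natAdj_closed hT (p := (· ∈ seen (g.arr 2) (g.reg 7)))
            (zero_mem_seen _) ?_ (Finset.mem_range.mp hv)
          intro u v huv hu
          obtain ⟨j, hj, ⟨rfl, rfl⟩ | ⟨rfl, rfl⟩⟩ := hadj u v huv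
          · exact (hsame heq.symm j hj).mp hu
          · exact (hsame heq.symm j hj).mpr hu
        have := Finset.card_le_card hall
        rw [hg.growth.1.card_seen, Finset.card_range] at this
        omega
  · rintro g ⟨hg, -, hmin⟩
    have := hg.growth.lt hn
    exact ⟨hg, by omega⟩

end Grow

/-! ### Correctness of the backward pass -/

section Merge

variable {n : ℕ} {T : SimpleGraph (Fin n)} {c : T.Coloring ℕ}

theorem wp_fetch {W : ℕ} {h : AState} (h5 : h.reg 5 < 3 * n) (hu : h.arr 2 (h.reg 5) < 3 * n)
    (hp : h.arr 3 (h.reg 5) < 3 * n) :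
    wp n W 15 fetch (fun g => g.arr = h.arr ∧ (∀ r < 8, g.reg r = h.reg r) ∧
      g.reg 8 = h.arr 2 (h.reg 5) ∧ g.reg 9 = h.arr 3 (h.reg 5) ∧
      g.reg 10 = h.arr 4 (h.arr 2 (h.reg 5)) ∧ g.reg 11 = h.arr 4 (h.arr 3 (h.reg 5)) ∧
      g.reg 12 = h.arr 5 (h.arr 2 (h.reg 5)) ∧ g.reg 13 = h.arr 5 (h.arr 3 (h.reg 5)) ∧
      g.reg 14 = h.arr 6 (h.arr 2 (h.reg 5)) ∧ g.reg 15 = h.arr 6 (h.arr 3 (h.reg 5)) ∧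
      g.reg 16 = h.arr 14 (h.arr 2 (h.reg 5)) ∧ g.reg 17 = h.arr 14 (h.arr 3 (h.reg 5))) h := by
  simp only [wp, fetch, AState.reg_setReg, AState.arr_setReg, ↓reduceIte, Nat.reduceEqDiff]
  refine ⟨by omega, by omega, by omega, by omega, by omega, by omega, by omega, by omega, by omega,
    by omega, trivial, fun r hr => ?_, trivial, trivial, trivial, trivial, trivial, trivial,
    trivial, trivial, trivial, trivial⟩
  have : ∀ s, 8 ≤ s → r ≠ s := fun s hs => by omega
  simp [this]

theorem wp_candidates {W : ℕ} {h : AState} (h2 : h.reg 13 ≤ h.reg 15)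
    (h3 : h.reg 15 + h.reg 10 ≤ W) (h4 : h.reg 15 + h.reg 14 ≤ W) :
    wp n W 15 candidates (fun g => g.arr = h.arr ∧ (∀ r < 15, g.reg r = h.reg r) ∧
      g.reg 15 = h.reg 15 + h.reg 14 ∧
      g.reg 18 = (if h.reg 16 < h.reg 17 then h.reg 12 else h.reg 14) ∧
      g.reg 19 = (if h.reg 17 < h.reg 16 then h.reg 13 else h.reg 15) + h.reg 10) h := by
  simp only [wp, candidates, AState.reg_setReg, ↓reduceIte, Nat.reduceEqDiff]
  have : ∀ r < 15, r ≠ 15 ∧ r ≠ 18 ∧ r ≠ 19 := fun r hr => by omega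
  refine ⟨fun c1 => ⟨fun c2 => ?_, fun c2 => ?_⟩, fun c1 => ⟨fun c2 => ?_, fun c2 => ?_⟩⟩
  all_goals
    refine ⟨by omega, h4, rfl, fun r hr => by simp [this r hr], trivial, ?_, ?_⟩
    all_goals simp [c1, c2]

theorem wp_minimize {W : ℕ} {h : AState} (h1 : h.reg 1 = 1) (h5 : h.reg 5 < 3 * n)
    (h9 : h.reg 9 < 3 * n) (ha : h.reg 11 + h.reg 10 ≤ W) (he : h.reg 13 + h.reg 10 ≤ W) :
    wp n W 15 minimize (fun g => (∀ r < 8, g.reg r = h.reg r) ∧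
      (∀ k, k < 4 ∨ 9 < k → g.arr k = h.arr k) ∧
      g.arr 4 = Function.update (h.arr 4) (h.reg 9) (h.reg 11 + min (h.reg 10) (h.reg 18)) ∧
      g.arr 5 = Function.update (h.arr 5) (h.reg 9) (h.reg 13 + min (h.reg 10) (h.reg 14)) ∧
      g.arr 6 = Function.update (h.arr 6) (h.reg 9) (min (h.reg 19) (h.reg 15)) ∧
      g.arr 7 = Function.update (h.arr 7) (h.reg 5) (1 - (h.reg 10 - h.reg 18)) ∧
      g.arr 8 = Function.update (h.arr 8) (h.reg 5) (1 - (h.reg 10 - h.reg 14)) ∧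
      g.arr 9 = Function.update (h.arr 9) (h.reg 5) (1 - (h.reg 19 - h.reg 15))) h := by
  have hmin : ∀ x y : ℕ, x - (x - y) = min x y := fun x y => by omega
  simp only [wp, minimize, AState.reg_setReg, AState.arr_setReg, AState.reg_setArr,
    AState.arr_setArr, ↓reduceIte, Nat.reduceEqDiff, OfNat.one_ne_ofNat, h1, hmin]
  refine ⟨by omega, by omega, by omega, by omega, by omega, by omega, by omega, by omega,
    fun r hr => ?_, fun k hk => ?_, trivial, trivial, trivial, trivial, trivial, trivial⟩
  · have : ∀ s, 8 ≤ s → r ≠ s := fun s hs => by omega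
    simp [this]
  · have : ∀ s, 4 ≤ s → s ≤ 9 → k ≠ s := fun s hs hs' => by omega
    simp [this]

/-- The state while the leaves are merged, with `k` steps to go. -/
structure Merging (T : SimpleGraph (Fin n)) (c : T.Coloring ℕ) (U P : ℕ → ℕ) (k : ℕ) (h : AState) :
    Prop where
  base : Base n (penalty T c) h
  color : h.arr 14 = natColor T c
  ends : h.arr 2 = U ∧ h.arr 3 = P
  rest : h.arr 10 = (fun _ => 0) ∧ h.arr 11 = fun _ => 0
  le : ∀ v < n, h.arr 5 v ≤ h.arr 6 v
  bits : ∀ j, k ≤ j → j < n - 1 → h.arr 7 j ≤ 1 ∧ h.arr 8 j ≤ 1 ∧ h.arr 9 j ≤ 1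
  solves : Solves (natColor T c) U P (h.arr 7) (h.arr 8) (h.arr 9) (n - 1) (fullCost T c U P)
    (h.arr 4) (h.arr 5) (h.arr 6) k

theorem wp_mergeAll {W : ℕ} (hn : 0 < n) (hW : 45 * (n * penalty T c) ≤ W) {x y : ℕ → ℕ}
    {h : AState} (hh : Growing T c x y h) (h7 : h.reg 7 = n - 1) :
    wp n W 15 mergeAll (Merging T c (h.arr 2) (h.arr 3) 0) h := by
  have hG := hh.growth
  rw [h7] at hG
  have hseen := hG.seen_eq hn
  generalize hU : h.arr 2 = U at hG hseen
  generalize hP : h.arr 3 = P at hG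
  simp only [wp, mergeAll]
  refine ⟨n - 1, fun k g => Merging T c U P (n - 1 - k) g ∧ g.reg 5 = n - 1 - k, by omega, ?_, ?_,
    ?_⟩
  · refine ⟨⟨hh.base.setReg _ _ (by omega), hh.color, ⟨hU, hP⟩, ⟨hh.rest 10 (by simp),
      hh.rest 11 (by simp)⟩, ?_, ?_, ?_⟩, ?_⟩
    · intro v _
      simp [hh.rest 5 (by simp)]
    · intro j hj hj'
      omega
    · intro z
      have : fullCost T c U P z = setCost (natColor T c) U P (h.arr 4) (h.arr 5) (h.arr 6)
          (n - 1) z := by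
        rw [fullCost, setCost, setCost]
        refine Finset.sum_congr rfl fun v hv => ?_
        rw [hseen, Finset.mem_range] at hv
        rw [hh.inC v hv, hh.outC v hv, hh.rest 5 (by simp)]
      simp [extend, this]
    · simp [hh.base.pred]
  · rintro k hk g ⟨hg, h5⟩
    obtain ⟨k', hk'⟩ : ∃ k', n - 1 - k = k' + 1 := ⟨n - 1 - k - 1, by omega⟩
    have hk'' : n - 1 - (k + 1) = k' := by omega
    rw [hk'] at hg h5
    beta_reduce
    rw [hk'']
    obtain ⟨hB, hcol, ⟨h2, h3⟩, ⟨h10, h11⟩, hle, hbits, hS⟩ := hg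
    obtain ⟨b0, b1, b2, b3, b4⟩ := hB
    have hlt : k' < n - 1 := by omega
    have hUn : U k' < n := (hG.2 k' hlt).1
    have hPn : P k' < n := (hG.2 k' hlt).2.1
    -- Costs of `u` and `p` are at most `n` penalties each, so the sums of two costs formed below
    -- fit into a word.
    have bU := hS.bound (B := n * penalty T c) (fullCost_le hG hn) (mem_seen_of_lt k'.lt_succ_self)
    have bP := hS.bound (B := n * penalty T c) (fullCost_le hG hn)
      (hG.1.parent_mem (show k' + 1 ≤ n - 1 by omega) k'.lt_succ_self)
    have leU := hle _ hUn
    have leP := hle _ hPn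
    refine ⟨by omega, ?_⟩
    simp only [h5, b1, Nat.add_sub_cancel]
    refine wp_mono _ ?_ (wp_fetch (by simp; omega) (by simp [h2]; omega) (by simp [h3]; omega))
    simp only [AState.arr_setReg, AState.reg_setReg, ↓reduceIte, h2, h3, hcol]
    rintro g₁ ⟨ga, gr, r8, r9, r10, r11, r12, r13, r14, r15, r16, r17⟩
    refine wp_mono _ ?_ (wp_candidates (by omega) (by omega) (by omega))
    rintro g₂ ⟨ga', gr', s15, s18, s19⟩
    rw [ga] at ga'
    refine wp_mono _ ?_ (wp_minimize ?_ ?_ ?_ ?_ ?_)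
    · rintro g₃ ⟨gr'', gk, g4, g5, g6, g7, g8, g9⟩
      have hreg : ∀ r < 8, g₃.reg r = if r = 5 then k' else g.reg r := fun r hr => by
        rw [gr'' r hr, gr' r (by omega), gr r hr]
      have f18 : g₂.reg 18 = leafOut (natColor T c) (g.arr 5) (g.arr 6) (U k') (P k') := by
        rw [s18, r12, r14, r16, r17]
        rfl
      have f19 : g₂.reg 19 = headOut (natColor T c) (g.arr 5) (g.arr 6) (U k') (P k') +
          g.arr 4 (U k') := by
        rw [s19, r10, r13, r15, r16, r17]
        rfl
      have f15 : g₂.reg 15 = g.arr 6 (P k') + g.arr 6 (U k') := by rw [s15, r14, r15]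
      have f5 : g₂.reg 5 = k' := by rw [gr' 5 (by omega), gr 5 (by omega)]; simp
      rw [ga', f18, gr' 9 (by omega), r9, gr' 11 (by omega), r11, gr' 10 (by omega), r10] at g4
      rw [ga', gr' 14 (by omega), r14, gr' 9 (by omega), r9, gr' 13 (by omega), r13,
        gr' 10 (by omega), r10] at g5
      rw [ga', f19, f15, gr' 9 (by omega), r9] at g6
      rw [ga', f5, f18, gr' 10 (by omega), r10] at g7
      rw [ga', f5, gr' 14 (by omega), r14, gr' 10 (by omega), r10] at g8
      rw [ga', f5, f19, f15] at g9
      refine ⟨⟨?_, ?_, ⟨?_, ?_⟩, ⟨?_, ?_⟩, ?_, ?_, ?_⟩, ?_⟩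
      · constructor <;> rw [hreg _ (by omega)] <;> simp [b0, b1, b2, b3, b4]
      · rw [gk 14 (by omega), ga', hcol]
      · rw [gk 2 (by omega), ga', h2]
      · rw [gk 3 (by omega), ga', h3]
      · rw [gk 10 (by omega), ga', h10]
      · rw [gk 11 (by omega), ga', h11]
      · intro v hv
        rw [g5, g6]
        by_cases hvp : v = P k'
        · subst hvp
          rw [Function.update_self, Function.update_self]
          exact mergeDom_le_mergeOut (c := natColor T c) leP
        · simpa [hvp] using hle v hv
      · intro j hj hj'
        rw [g7, g8, g9]
        by_cases hjk : j = k'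
        · subst hjk
          simp
        · simpa [hjk] using hbits j (by omega) hj'
      · rw [g4, g5, g6, g7, g8, g9]
        exact hS.merge hG.1 hlt (by omega) (by omega) (by omega)
      · rw [hreg 5 (by omega)]
        simp
    · rw [gr' 1 (by omega), gr 1 (by omega)]
      simpa using b1
    · rw [gr' 5 (by omega), gr 5 (by omega)]
      simp
      omega
    · rw [gr' 9 (by omega), r9]
      omega
    · rw [gr' 10 (by omega), gr' 11 (by omega), r10, r11]
      omega
    · rw [gr' 10 (by omega), gr' 13 (by omega), r10, r13]
      omega
  · rintro g ⟨hg, h5⟩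
    rw [Nat.sub_self] at hg h5
    exact ⟨by omega, hg⟩

end Merge

/-! ### Correctness of the forward pass and the output -/

section Assign

variable {n : ℕ} {T : SimpleGraph (Fin n)} {c : T.Coloring ℕ}

/-- The entry of the table for the state of `p`. -/
def pick (h : AState) (i p : ℕ) : ℕ :=
  if 0 < h.arr 10 p then h.arr 7 i else if 0 < h.arr 11 p then h.arr 8 i else h.arr 9 i

theorem wp_chooseNext {W : ℕ} {h : AState} (h0 : h.reg 0 = 0) (h5 : h.reg 5 < 3 * n)
    (hu : h.arr 2 (h.reg 5) < 3 * n) (hp : h.arr 3 (h.reg 5) < 3 * n) :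
    wp n W 15 chooseNext (fun g => (∀ k, k ≠ 10 → g.arr k = h.arr k) ∧
      (∀ r < 8, g.reg r = h.reg r) ∧
      g.reg 8 = h.arr 2 (h.reg 5) ∧ g.reg 9 = h.arr 3 (h.reg 5) ∧
      g.reg 10 = h.arr 10 (h.arr 3 (h.reg 5)) ∧
      g.reg 12 = pick h (h.reg 5) (h.arr 3 (h.reg 5)) ∧
      g.arr 10 = Function.update (h.arr 10) (h.arr 2 (h.reg 5))
        (pick h (h.reg 5) (h.arr 3 (h.reg 5)))) h := by
  have hreg : ∀ r < 8, r ≠ 8 ∧ r ≠ 9 ∧ r ≠ 10 ∧ r ≠ 11 ∧ r ≠ 12 := fun r hr => by omega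
  simp only [wp, chooseNext, AState.reg_setReg, AState.arr_setReg, AState.reg_setArr,
    AState.arr_setArr, ↓reduceIte, Nat.reduceEqDiff, OfNat.zero_ne_ofNat, h0]
  refine ⟨by omega, by omega, by omega, by omega, fun c1 => ⟨by omega, by omega, ?_⟩,
    fun c1 => ⟨fun c2 => ⟨by omega, by omega, ?_⟩, fun c2 => ⟨by omega, by omega, ?_⟩⟩⟩
  all_goals
    refine ⟨fun k hk => by simp [hk], fun r hr => by simp [hreg r hr], trivial, trivial, trivial,
      ?_, ?_⟩
  · simp only [pick, c1, ↓reduceIte]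
  · simp only [pick, c1, ↓reduceIte]
  · simp only [pick, c1, c2, ↓reduceIte]
  · simp only [pick, c1, c2, ↓reduceIte]
  · simp only [pick, c1, c2, ↓reduceIte]
  · simp only [pick, c1, c2, ↓reduceIte]

theorem wp_markDominated {W : ℕ} {h : AState} (h0 : h.reg 0 = 0) (h1 : h.reg 1 = 1)
    (h8 : h.reg 8 < 3 * n) (h9 : h.reg 9 < 3 * n) :
    wp n W 15 markDominated (fun g => (∀ k, k ≠ 11 → g.arr k = h.arr k) ∧
      (∀ r < 8, g.reg r = h.reg r) ∧
      ∀ v, 0 < g.arr 11 v ↔ 0 < h.arr 11 v ∨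
        (v = h.reg 8 ∧ 0 < h.reg 10 ∧ h.arr 14 v < h.arr 14 (h.reg 9)) ∨
        (v = h.reg 9 ∧ 0 < h.reg 12 ∧ h.arr 14 v < h.arr 14 (h.reg 8))) h := by
  have hreg : ∀ r < 8, r ≠ 8 ∧ r ≠ 16 ∧ r ≠ 17 := fun r hr => by omega
  simp only [wp, markDominated, skip, AState.reg_setReg, AState.arr_setReg, AState.reg_setArr,
    AState.arr_setArr, ↓reduceIte, Nat.reduceEqDiff, OfNat.zero_ne_ofNat, OfNat.one_ne_ofNat, h0,
    h1]
  refine ⟨by omega, by omega, fun c1 => ⟨fun c2 => ⟨by omega, fun c3 => ⟨fun c4 => ⟨by omega, ?_⟩,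
    fun c4 => ?_⟩, fun c3 => ?_⟩, fun c2 => ⟨fun c3 => ⟨fun c4 => ⟨by omega, ?_⟩,
    fun c4 => ?_⟩, fun c3 => ?_⟩⟩, fun c1 => ⟨fun c3 => ⟨fun c4 => ⟨by omega, ?_⟩,
    fun c4 => ?_⟩, fun c3 => ?_⟩⟩
  all_goals
    refine ⟨fun k hk => by simp [hk], fun r hr => by simp [hreg r hr], fun v => ?_⟩
    by_cases hv : v = h.reg 8 <;> by_cases hv' : v = h.reg 9 <;>
      simp [Function.update_apply] <;> grind

theorem wp_assign {W : ℕ} (hn : 0 < n) (hW : 45 * n ≤ W) {U P : ℕ → ℕ}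
    (hG : IsTreeGrowth T U P (n - 1)) {h : AState} (hh : Merging T c U P 0 h) :
    wp n W 15 assign (fun g => Base n (penalty T c) g ∧ (∀ v, g.arr 10 v ≤ 1) ∧
      ∀ y, fullCost T c U P (g.arr 10) ≤ fullCost T c U P y) h := by
  obtain ⟨⟨b0, b1, b2, b3, b4⟩, hcol, ⟨h2, h3⟩, ⟨h10, h11⟩, -, hbits, hS⟩ := hh
  generalize hdI : h.arr 7 = dI at hbits hS
  generalize hdE : h.arr 8 = dE at hbits hS
  generalize hdB : h.arr 9 = dB at hbits hS
  have hroot := hS.root (i := 1 - (h.arr 4 0 - h.arr 6 0)) (by omega)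
  generalize hfin : extend (natColor T c) U P dI dE dB (n - 1) 0
    (Function.update (fun _ => 0) 0 (1 - (h.arr 4 0 - h.arr 6 0))) = final at hroot
  simp only [wp, assign, chooseRoot, AState.reg_setReg, AState.arr_setReg, ↓reduceIte,
    Nat.reduceEqDiff, OfNat.zero_ne_ofNat, OfNat.one_ne_ofNat, b0, b1]
  refine ⟨by omega, by omega, by omega, ?_⟩
  -- The invariant fixes the goal: extending the current set along the remaining steps always yields
  -- `final`. After the last step the array is `final` itself.
  refine wp_forUp (n - 1) (by omega) (by omega) (fun k g => Base n (penalty T c) g ∧ g.reg 5 = k ∧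
    g.arr 14 = natColor T c ∧ g.arr 2 = U ∧ g.arr 3 = P ∧ g.arr 7 = dI ∧ g.arr 8 = dE ∧
    g.arr 9 = dB ∧ (∀ v, g.arr 10 v ≤ 1) ∧
    extend (natColor T c) U P dI dE dB (n - 1 - k) k (g.arr 10) = final ∧
    ∀ v, 0 < g.arr 11 v ↔ UpDom (natColor T c) U P k (g.arr 10) v) ?_ ?_ ?_ ?_
  · refine ⟨?_, by simp, by simpa using hcol, by simpa using h2, by simpa using h3,
      by simpa using hdI, by simpa using hdE, by simpa using hdB, fun v => ?_, ?_, fun v => ?_⟩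
    · constructor <;> simp [b0, b1, b2, b3, b4]
    · simp only [AState.arr_setReg, AState.arr_setArr, ↓reduceIte, h10, Function.update_apply]
      split_ifs <;> omega
    · simpa [h10] using hfin
    · simp [h11, UpDom]
  · rintro k g ⟨hB, h5, -⟩
    exact ⟨h5, hB.pred⟩
  · rintro k hk g ⟨⟨b0, b1, b2, b3, b4⟩, h5, hcol, h2, h3, h7, h8, h9, hx1, hext, hdom⟩
    have hUn : U k < n := (hG.2 k hk).1
    have hPn : P k < n := (hG.2 k hk).2.1
    have hpick : pick g k (P k) = choice (natColor T c) U P dI dE dB k (g.arr 10) := by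
      have := hdom (P k)
      simp only [pick, choice, h7, h8, h9]
      split_ifs <;> tauto
    refine wp_seq (wp_chooseNext b0 (by omega) (by rw [h5, h2]; omega)
      (by rw [h5, h3]; omega)) ?_
    rintro g₁ ⟨ga, gr, r8, r9, r10, r12, ga10⟩
    rw [h5, h3, hpick] at r12 ga10
    rw [h2] at ga10
    rw [h5, h2] at r8
    rw [h5, h3] at r9 r10
    refine wp_mono _ ?_ (wp_markDominated (by rw [gr 0 (by omega), b0])
      (by rw [gr 1 (by omega), b1]) (by omega) (by omega))
    rintro g₂ ⟨ga', gr', hmark⟩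
    have hreg : ∀ r < 8, g₂.reg r = g.reg r := fun r hr => by rw [gr' r hr, gr r hr]
    have harr : ∀ k, k ≠ 10 → k ≠ 11 → g₂.arr k = g.arr k := fun k hk hk' => by
      rw [ga' k hk', ga k hk]
    have hne : P k ≠ U k := fun he => (hG.1 k hk).2 (he ▸ (hG.1 k hk).1)
    have hx : g₂.arr 10 = Function.update (g.arr 10) (U k)
        (choice (natColor T c) U P dI dE dB k (g.arr 10)) := by rw [ga' 10 (by omega), ga10]
    refine ⟨by rw [hreg 1 (by omega), b1], by rw [hreg 5 (by omega), h5], ?_, by simp, ?_, ?_, ?_,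
      ?_, ?_, ?_, ?_, ?_, ?_⟩
    · refine Base.setReg ?_ _ _ (by omega)
      constructor <;> rw [hreg _ (by omega)] <;> assumption
    · simp [harr, hcol]
    · simp [harr, h2]
    · simp [harr, h3]
    · simp [harr, h7]
    · simp [harr, h8]
    · simp [harr, h9]
    · intro v
      rw [AState.arr_setReg, hx, Function.update_apply]
      obtain ⟨i1, i2, i3⟩ := hbits k (Nat.zero_le k) hk
      split_ifs
      · rw [choice]
        split_ifs <;> assumption
      · exact hx1 v
    · rw [AState.arr_setReg, hx, ← hext, show n - 1 - k = n - 1 - (k + 1) + 1 by omega]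
      rfl
    · intro v
      rw [AState.arr_setReg, hmark, upDom_succ, hx, r8, r9, r10, r12, ga 11 (by omega),
        ga 14 (by omega), hcol, hdom, Function.update_self, Function.update_of_ne hne,
        upDom_congr hG.1 hk.le (x := g.arr 10)]
      intro w hw
      rw [Function.update_of_ne]
      rintro rfl
      exact (hG.1 k hk).2 hw
  · rintro g ⟨hB, -, -, -, -, -, -, -, hx1, hext, -⟩
    rw [Nat.sub_self] at hext
    change g.arr 10 = final at hext
    exact ⟨hB, hx1, fun y => hext ▸ hroot y⟩

theorem wp_output {W M : ℕ} (hW : 45 * n ≤ W) {h : AState} (hB : Base n M h) :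
    wp n W 15 output (fun g => ∀ v < n, g.arr 0 v = h.arr 10 v) h := by
  refine wp_forUp n le_rfl (by omega) (fun k g => Base n M g ∧ g.reg 5 = k ∧
    g.arr 10 = h.arr 10 ∧ ∀ v < k, g.arr 0 v = h.arr 10 v) ?_ ?_ ?_ ?_
  · exact ⟨hB.setReg _ _ (by omega), by simp, rfl, by simp⟩
  · rintro k g ⟨hB, h5, -⟩
    exact ⟨h5, hB.size⟩
  · rintro k hk g ⟨⟨b0, b1, b2, b3, b4⟩, h5, h10, hv⟩
    simp only [wp, AState.reg_setReg, AState.arr_setReg, AState.reg_setArr,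
      AState.arr_setArr, ↓reduceIte, Nat.reduceEqDiff, OfNat.one_ne_ofNat, OfNat.ofNat_ne_zero,
      h5, h10, b1]
    refine ⟨by omega, by omega, trivial, trivial, ?_, trivial, trivial, fun v hvk => ?_⟩
    · constructor <;> simp [b0, b1, b2, b3, b4]
    · rcases Nat.lt_succ_iff_lt_or_eq.mp hvk with hlt | rfl
      · rw [Function.update_of_ne hlt.ne, hv v hlt]
      · rw [Function.update_self]
  · rintro g ⟨-, -, -, hv⟩
    exact hv

end Assign

/-! ### Assembly of the program and the asymptotic bounds -/

section Main

/-- Register `0` gets the length of the arrays. -/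
def prologue : Program :=
  .seq (.load 0 0) (.seq (.add 1 0 0) (.add 0 1 0))

/-- The array state that the initial state represents. -/
def initialArrays {n : ℕ} (c : Fin n → ℕ) (L : List (Fin n × Fin n)) : AState where
  reg _ := 0
  arr k i := if k = 0 then (inputWords c L).getD i 0 else 0

theorem exec_prologue {n S W : ℕ} (hn : 0 < n) (hS : 0 < S) (hW : 3 * n ≤ W) (c : Fin n → ℕ)
    (L : List (Fin n × Fin n)) (hL : L.length = n - 1) :
    ∃ τ, Exec S W prologue (initialState c L) 3 τ ∧ Rep n τ (initialArrays c L) := by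
  refine ⟨_, .seq (t := 1) (u := 2) (.load _ 0 0 hS) (.seq (t := 1) (u := 1)
    (.add _ 1 0 0 ?_) (.add _ 0 1 0 ?_)), ?_, ?_, ?_⟩
  · simp [State.setReg, initialState, inputWords]
    omega
  · simp [State.setReg, initialState, inputWords]
    omega
  · simp [State.setReg, initialState, inputWords]
    omega
  · intro r
    simp [State.setReg, initialState, initialArrays]
  · intro k i hi
    simp only [State.setReg, initialState, initialArrays]
    split_ifs with hk
    · simp [hk]
    · refine List.getD_eq_default _ _ ?_
      -- The input has `n + 1 + 2 * (n - 1) = 3 * n - 1` words, so it fits into array `0` and all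
      -- later arrays start at zero. This is the reason for the length `3 * n`.
      rw [length_inputWords, hL]
      have : 3 * n ≤ k * (3 * n) := Nat.le_mul_of_pos_left _ (Nat.pos_of_ne_zero hk)
      omega

theorem wp_main {n W : ℕ} {T : SimpleGraph (Fin n)} {c : T.Coloring ℕ} (hT : T.IsTree)
    (hn : 0 < n) (hc : ∃ v, c v ≠ 0) (hW : 45 * (n * penalty T c) ≤ W)
    {L : List (Fin n × Fin n)} (hL : IsEdgeList T L) :
    wp n W 15 main (fun g => ∃ D : Finset (Fin n),
      (∀ i : Fin n, g.arr 0 i = if i ∈ D then 1 else 0) ∧ IsOmegaUCDominating T c D)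
      (initialArrays c L) := by
  have hM : 0 < penalty T c := by simp [penalty]
  have hW' : 45 * n ≤ W := by nlinarith
  have hlen := hL.length_eq hT
  -- The default `0` beyond the list is never used, since only indices below `n - 1` occur.
  let x : ℕ → ℕ := fun j => if h : j < L.length then (L[j].1 : ℕ) else 0
  let y : ℕ → ℕ := fun j => if h : j < L.length then (L[j].2 : ℕ) else 0
  have hx : ∀ j (hj : j < L.length), x j = L[j].1 := fun j hj => dif_pos hj
  have hy : ∀ j (hj : j < L.length), y j = L[j].2 := fun j hj => dif_pos hj
  have hxy : ∀ j < n - 1, NatAdj T (x j) (y j) := by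
    intro j hj
    rw [← hlen] at hj
    rw [hx j hj, hy j hj]
    refine ⟨Fin.is_lt _, Fin.is_lt _, ?_⟩
    have := (hL.2 s(L[j].1, L[j].2)).mp (List.mem_map.mpr ⟨L[j], List.getElem_mem hj, rfl⟩)
    simpa using this
  have hadj : ∀ u v, NatAdj T u v → ∃ j < n - 1, (u = x j ∧ v = y j) ∨ (u = y j ∧ v = x j) := by
    rintro u v ⟨hu, hv, h⟩
    obtain ⟨e, he, heq⟩ := List.mem_map.mp ((hL.2 s(⟨u, hu⟩, ⟨v, hv⟩)).mpr (by simpa using h))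
    obtain ⟨j, hj, rfl⟩ := List.mem_iff_getElem.mp he
    refine ⟨j, hlen ▸ hj, ?_⟩
    rw [hx j hj, hy j hj]
    rcases Sym2.eq_iff.mp heq with ⟨h1, h2⟩ | ⟨h1, h2⟩
    · exact .inl ⟨by rw [h1], by rw [h2]⟩
    · exact .inr ⟨by rw [h2], by rw [h1]⟩
  have h₁ := wp_readColors T c hn hW (w := fun i => (inputWords c L).getD i 0)
    (h := initialArrays c L) (inputWords_zero c L)
    (fun v hv => by
      have := inputWords_color c L ⟨v, hv⟩
      rw [← natColor_coe] at this
      exact this)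
    (fun _ => rfl) rfl (fun k hk => by simp [initialArrays, hk])
  refine wp_seq h₁ fun g₁ hg₁ => ?_
  refine wp_seq (wp_initCosts T c hn hW hg₁) fun g₂ hg₂ => ?_
  refine wp_seq (wp_readEdges T c hn hW (x := x) (y := y) (fun j hj => ?_) (fun j hj => ?_) hg₂)
    fun g₃ hg₃ => ?_
  rotate_left 2
  · refine wp_seq (wp_grow hT hn hW' hxy hadj hg₃) fun g₄ hg₄ => ?_
    obtain ⟨hg₄, h7⟩ := hg₄
    refine wp_seq (wp_mergeAll hn hW hg₄ h7) fun g₅ hg₅ => ?_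
    have hG := hg₄.growth
    rw [h7] at hG
    refine wp_seq (wp_assign hn hW' hG hg₅) fun g₆ hg₆ => ?_
    obtain ⟨hB, h1, hmin⟩ := hg₆
    refine wp_mono output (fun g₇ hg₇ => ?_) (wp_output hW' hB)
    refine ⟨Finset.univ.filter fun v : Fin n => 0 < g₆.arr 10 v, fun i => ?_,
      isOmegaUCDominating_of_forall_fullCost_le hG hT hn hc hmin (by simp)⟩
    have := h1 i
    rw [hg₇ i i.2]
    simp only [Finset.mem_filter, Finset.mem_univ, true_and]
    split_ifs <;> omega
  · rw [← hlen] at hj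
    rw [hx j hj]
    exact (inputWords_edge c L j hj).1
  · rw [← hlen] at hj
    rw [hy j hj]
    exact (inputWords_edge c L j hj).2

theorem isBigO_time (A : ℕ) :
    (fun n : ℕ => ((3 + A * (n + 1) ^ 2 : ℕ) : ℝ)) =O[Filter.atTop]
      (fun n : ℕ => (n : ℝ) ^ 2 * Real.log n) := by
  refine Asymptotics.IsBigO.of_bound (3 + A * 4) ?_
  filter_upwards [Filter.eventually_ge_atTop 3] with n hn
  have hn' : (3 : ℝ) ≤ n := by exact_mod_cast hn
  -- From `e < 3 ≤ n`. The running time is quadratic, and the logarithm is needed only as a factor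
  -- of at least `1`.
  have hlog : 1 ≤ Real.log n := by
    rw [Real.le_log_iff_exp_le (by linarith)]
    linarith [Real.exp_one_lt_three]
  have hA : (0 : ℝ) ≤ A := Nat.cast_nonneg A
  have h1 : (n : ℝ) ^ 2 ≤ (n : ℝ) ^ 2 * Real.log n := le_mul_of_one_le_right (by positivity) hlog
  rw [Real.norm_of_nonneg (by positivity), Real.norm_of_nonneg (by positivity)]
  push_cast
  calc (3 : ℝ) + A * (n + 1) ^ 2 ≤ 3 * (n : ℝ) ^ 2 + A * (4 * (n : ℝ) ^ 2) := by
        gcongr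
        · nlinarith
        · nlinarith
    _ = (3 + A * 4) * (n : ℝ) ^ 2 := by ring
    _ ≤ _ := by gcongr

theorem isBigO_space :
    (fun n : ℕ => ((15 * (3 * n) : ℕ) : ℝ)) =O[Filter.atTop] (fun n : ℕ => (n : ℝ) ^ 2) := by
  refine Asymptotics.IsBigO.of_bound 45 ?_
  filter_upwards [Filter.eventually_ge_atTop 1] with n hn
  have hn' : (1 : ℝ) ≤ n := by exact_mod_cast hn
  rw [Real.norm_of_nonneg (by positivity), Real.norm_of_nonneg (by positivity)]
  push_cast
  nlinarith

end Main

end UpColor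

theorem mainTheorem6 :
    ∃ (P : UpColor.Program) (K : ℕ) (time space : ℕ → ℕ),
      (fun n : ℕ => (time n : ℝ)) =O[Filter.atTop] (fun n : ℕ => (n : ℝ) ^ 2 * Real.log n) ∧
      (fun n : ℕ => (space n : ℝ)) =O[Filter.atTop] (fun n : ℕ => (n : ℝ) ^ 2) ∧
      ∀ (n : ℕ) (T : SimpleGraph (Fin n)) (_ : T.IsTree) (c : T.Coloring ℕ)
        (_ : ∃ v, c v ≠ 0) (L : List (Fin n × Fin n)) (_ : UpColor.IsEdgeList T L),
        ∃ (t : ℕ) (τ : UpColor.State) (D : Finset (Fin n)),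
          t ≤ time n ∧
          UpColor.Exec (space n) ((n + ∑ v, c v) ^ K) P (UpColor.initialState c L) t τ ∧
          UpColor.Outputs τ D ∧
          UpColor.IsOmegaUCDominating T c D := by
  obtain ⟨A, hA⟩ := UpColor.Cmd.exists_cost_le UpColor.Cmd.main
  refine ⟨.seq UpColor.prologue UpColor.Cmd.main.compile, 8, fun n => 3 + A * (n + 1) ^ 2,
    fun n => 15 * (3 * n), UpColor.isBigO_time A, UpColor.isBigO_space, ?_⟩
  intro n T hT c hc L hL
  have hn : 0 < n := Fin.pos hc.choose
  have hlen := hL.length_eq hT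
  have hsum : 0 < ∑ v, c v := by
    obtain ⟨v, hv⟩ := hc
    exact Finset.sum_pos' (fun _ _ => Nat.zero_le _) ⟨v, Finset.mem_univ v, Nat.pos_of_ne_zero hv⟩
  -- The base is at least `2`, as both `n` and the colour sum are positive. Six factors absorb `45 ≤
  -- 2 ^ 6`, and two more absorb `n` and the penalty, whence the exponent `8`.
  have hW : 45 * (n * UpColor.penalty T c) ≤ (n + ∑ v, c v) ^ 8 := by
    have h1 : UpColor.penalty T c ≤ n + ∑ v, c v := Nat.add_le_add_right hn _
    have h2 : n ≤ n + ∑ v, c v := Nat.le_add_right _ _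
    have h3 : 2 ≤ n + ∑ v, c v := by omega
    calc 45 * (n * UpColor.penalty T c) ≤ 2 ^ 6 * ((n + ∑ v, c v) * (n + ∑ v, c v)) := by
          gcongr
          norm_num
      _ ≤ (n + ∑ v, c v) ^ 6 * ((n + ∑ v, c v) * (n + ∑ v, c v)) := by gcongr
      _ = _ := by ring
  have hW' : 45 * n ≤ (n + ∑ v, c v) ^ 8 := by
    refine le_trans ?_ hW
    have : 0 < UpColor.penalty T c := by simp [UpColor.penalty]
    gcongr
    exact Nat.le_mul_of_pos_right n this
  obtain ⟨σ, hσ, hR⟩ := UpColor.exec_prologue (S := 15 * (3 * n)) hn (by omega)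
    (show 3 * n ≤ (n + ∑ v, c v) ^ 8 by omega) c L hlen
  obtain ⟨t, τ, g, ht, hE, hR', D, hD, hopt⟩ := UpColor.Cmd.exists_exec_of_wp (by omega)
    UpColor.Cmd.main (UpColor.wp_main hT hn hc hW hL) hR
  -- The prologue takes `3` steps, and the loop depth of `main` evaluates to `2`. Array `0` lies at
  -- the start of the memory, where the output is expected.
  refine ⟨3 + t, τ, D, Nat.add_le_add_left (ht.trans (hA n)) 3, .seq hσ hE, fun i => ?_, hopt⟩
  rw [← hD i, ← hR'.2.2 0 i (by omega)]
  simp
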